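/- Let $M$ be a smooth manifold of any dimension $n$ (including $n=2$), and let $(g,\nabla)$ be a statistical structure on $M$: $g$ is a smooth Riemannian metric and $\nabla$ is a smooth torsion-free affine connection such that the cubic form $$(\nabla g)(X,Y,Z)=X\,g(Y,Z)-g(\nabla_XY,Z)-g(Y,\nabla_XZ)$$ is symmetric in all its arguments. Let $\overline\nabla$ be the dual connection, defined by $$X\,g(Y,Z)=g(\nabla_XY,Z)+g(Y,\overline\nabla_XZ),$$ and assume that $(g,\nabla)$ is conjugate symmetric, that is, the curvature tensors of $\nabla$ and $\overline\nabla$ coincide: $R=\overline R$. Then $\nabla$ is projectively flat if and only if $\overline\nabla$ is projectively flat. Here a torsion-free connection $\nabla$ is called projectively flat if every point of $M$ has an open neighbourhood $U$ on which there are a smooth torsion-free connection $\nabla'$ with vanishing curvature and a smooth $1$-form $\rho$ such that $\nabla'_XY=\nabla_XY+\rho(X)Y+\rho(Y)X$ for all smooth vector fields $X,Y$ on $U$. -/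

import Mathlib

open Bundle Manifold Set VectorField
open scoped ContDiff Topology

namespace StatGeom

noncomputable section

variable
  {E : Type*} [NormedAddCommGroup E] [NormedSpace ℝ E]
  {H : Type*} [TopologicalSpace H] {I : ModelWithCorners ℝ E H}
  {M : Type*} [TopologicalSpace M] [ChartedSpace H M]

/-! Connections on the tangent bundle are Mathlib's covariant derivatives: `D Y x v` is `∇_v Y` at
the point `x`, so `∇_X Y` is the vector field `fun x ↦ D Y x (X x)`. -/

/-- The curvature `R(X, Y)Z = ∇_X ∇_Y Z - ∇_Y ∇_X Z - ∇_[X,Y] Z`, evaluated at `x`. -/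
def curvature
    (D : (Π x : M, TangentSpace I x) → (Π x : M, TangentSpace I x →L[ℝ] TangentSpace I x))
    (X Y Z : Π x : M, TangentSpace I x) (x : M) : TangentSpace I x :=
  D (fun y ↦ D Z y (Y y)) x (X x) - D (fun y ↦ D Z y (X y)) x (Y x)
    - D Z x (mlieBracket I X Y x)

/-- `D` is a smooth torsion-free connection with vanishing curvature on the set `U` (to be used
for open `U`); nothing is asked about `D` outside of `U`. -/
structure IsFlatOn [IsManifold I 1 M]
    (D : (Π x : M, TangentSpace I x) → (Π x : M, TangentSpace I x →L[ℝ] TangentSpace I x))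
    (U : Set M) : Prop where
  isCovariantDerivativeOn : IsCovariantDerivativeOn E D U
  smooth : ContMDiffCovariantDerivativeOn E ∞ D U
  torsion_eq_zero : ∀ X Y : (Π x : M, TangentSpace I x), CMDiff[U] ∞ (T% X) → CMDiff[U] ∞ (T% Y) →
    ∀ x ∈ U, D Y x (X x) - D X x (Y x) - mlieBracket I X Y x = 0
  curvature_eq_zero : ∀ X Y Z : (Π x : M, TangentSpace I x),
    CMDiff[U] ∞ (T% X) → CMDiff[U] ∞ (T% Y) → CMDiff[U] ∞ (T% Z) →
    ∀ x ∈ U, curvature D X Y Z x = 0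

/-- Projective equivalence on `U`: there is a smooth 1-form `ρ` on `U` such that
`D'_X Y = D_X Y + ρ(X) Y + ρ(Y) X` on `U`. -/
def ProjectivelyEquivalentOn [IsManifold I 1 M]
    (D D' : (Π x : M, TangentSpace I x) → (Π x : M, TangentSpace I x →L[ℝ] TangentSpace I x))
    (U : Set M) : Prop :=
  ∃ ρ : Π x : M, TangentSpace I x →L[ℝ] ℝ,
    ContMDiffOn I (I.prod 𝓘(ℝ, E →L[ℝ] ℝ)) ∞
      (fun x ↦ (TotalSpace.mk' (E →L[ℝ] ℝ) x (ρ x) :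
        TotalSpace (E →L[ℝ] ℝ) (fun x : M ↦ TangentSpace I x →L[ℝ] ℝ))) U ∧
    ∀ Y : (Π x : M, TangentSpace I x), CMDiff[U] ∞ (T% Y) → ∀ x ∈ U, ∀ v : TangentSpace I x,
      D' Y x v = D Y x v + ρ x v • Y x + ρ x (Y x) • v

/-- A connection is projectively flat if around each point it is projectively equivalent to a
flat (that is, torsion-free and of zero curvature) connection. -/
def IsProjectivelyFlat [IsManifold I 1 M]
    (cov : CovariantDerivative I E (TangentSpace I : M → Type _)) : Prop :=
  ∀ p : M, ∃ U : Set M, IsOpen U ∧ p ∈ U ∧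
    ∃ D : (Π x : M, TangentSpace I x) → (Π x : M, TangentSpace I x →L[ℝ] TangentSpace I x),
      IsFlatOn D U ∧ ProjectivelyEquivalentOn cov.toFun D U

section Riemannian

/-! The Riemannian metric `g` is `inner ℝ` on the tangent spaces. -/

variable [FiniteDimensional ℝ E]
  [RiemannianBundle (fun x : M ↦ TangentSpace I x)]

/-- The vector representing a linear form on a tangent space with respect to `g`. -/
def sharp (x : M) : (TangentSpace I x →L[ℝ] ℝ) →L[ℝ] TangentSpace I x :=
  haveI : FiniteDimensional ℝ (TangentSpace I x) := inferInstanceAs (FiniteDimensional ℝ E)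
  haveI : CompleteSpace (TangentSpace I x) := FiniteDimensional.complete ℝ _
  { toFun := fun α ↦ (InnerProductSpace.toDual ℝ (TangentSpace I x)).symm α
    map_add' := fun α β ↦ map_add _ α β
    map_smul' := fun c α ↦ by simp
    cont := (InnerProductSpace.toDual ℝ (TangentSpace I x)).symm.continuous }

lemma inner_sharp (x : M) (α : TangentSpace I x →L[ℝ] ℝ) (y : TangentSpace I x) :
    inner ℝ y (sharp x α) = α y := by
  have : FiniteDimensional ℝ (TangentSpace I x) := inferInstanceAs (FiniteDimensional ℝ E)
  have : CompleteSpace (TangentSpace I x) := FiniteDimensional.complete ℝ _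
  rw [real_inner_comm]
  exact InnerProductSpace.toDual_symm_apply (𝕜 := ℝ) (E := TangentSpace I x)

variable [IsManifold I ∞ M]
  [IsContMDiffRiemannianBundle I ∞ E (fun x : M ↦ TangentSpace I x)]

/-- The cubic form `(∇g)(X, Y, Z) = X g(Y, Z) - g(∇_X Y, Z) - g(Y, ∇_X Z)`. -/
def cubicForm (cov : CovariantDerivative I E (TangentSpace I : M → Type _)) (x : M)
    (u v w : TangentSpace I x) : ℝ :=
  cov.derivMetricTensor x v w u

/-- `(g, ∇)` is a statistical structure: `∇` is a smooth torsion-free connection and the cubic form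
`∇g` is symmetric in all its arguments. -/
structure IsStatistical (cov : CovariantDerivative I E (TangentSpace I : M → Type _)) :
    Prop where
  smooth : CovariantDerivative.ContMDiffCovariantDerivative cov ∞
  torsion_eq_zero : cov.torsion = 0
  cubicForm_symm : ∀ (x : M) (u v w : TangentSpace I x),
    cubicForm cov x u v w = cubicForm cov x v u w ∧ cubicForm cov x u v w = cubicForm cov x u w v

lemma cubicForm_add (cov : CovariantDerivative I E (TangentSpace I : M → Type _)) (x : M)
    (v z z' y : TangentSpace I x) :
    cubicForm cov x v (z + z') y = cubicForm cov x v z y + cubicForm cov x v z' y := by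
  have h := (cov.derivMetricTensor x).map_add z z'
  simp only [cubicForm, h]
  rfl

lemma cubicForm_smul (cov : CovariantDerivative I E (TangentSpace I : M → Type _)) (x : M)
    (c : ℝ) (v z y : TangentSpace I x) :
    cubicForm cov x v (c • z) y = c • cubicForm cov x v z y := by
  have h := (cov.derivMetricTensor x).map_smul c z
  simp only [cubicForm, h]
  rfl

/-- The linear form `y ↦ (∇g)(v, z, y)`. -/
def cubicFormLast (cov : CovariantDerivative I E (TangentSpace I : M → Type _)) (x : M)
    (v z : TangentSpace I x) : TangentSpace I x →L[ℝ] ℝ :=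
  haveI : FiniteDimensional ℝ (TangentSpace I x) := inferInstanceAs (FiniteDimensional ℝ E)
  LinearMap.toContinuousLinearMap
    { toFun := fun y ↦ cubicForm cov x v z y
      map_add' := fun y y' ↦ by simp [cubicForm]
      map_smul' := fun c y ↦ by simp [cubicForm] }

/-- The bilinear map `(z, v) ↦ ((∇g)(v, z, ·))♯`. -/
def dualCorrection (cov : CovariantDerivative I E (TangentSpace I : M → Type _)) (x : M) :
    TangentSpace I x →L[ℝ] TangentSpace I x →L[ℝ] TangentSpace I x :=
  haveI : FiniteDimensional ℝ (TangentSpace I x) := inferInstanceAs (FiniteDimensional ℝ E)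
  LinearMap.toContinuousLinearMap
    { toFun := fun z ↦ LinearMap.toContinuousLinearMap
        { toFun := fun v ↦ sharp x (cubicFormLast cov x v z)
          map_add' := fun v v' ↦ by
            rw [← map_add]; congr 1; ext y; simp [cubicFormLast, cubicForm]
          map_smul' := fun c v ↦ by
            rw [← map_smul]; congr 1; ext y; simp [cubicFormLast, cubicForm] }
      map_add' := fun z z' ↦ by
        ext v
        simp only [LinearMap.coe_toContinuousLinearMap', LinearMap.coe_mk, AddHom.coe_mk,
          _root_.add_apply]
        rw [← map_add]; congr 1; ext y; exact cubicForm_add cov x v z z' y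
      map_smul' := fun c z ↦ by
        ext v
        simp only [LinearMap.coe_toContinuousLinearMap', LinearMap.coe_mk, AddHom.coe_mk,
          _root_.smul_apply, RingHom.id_apply]
        rw [← map_smul]; congr 1; ext y; exact cubicForm_smul cov x c v z y }

/-- The dual connection of `∇` with respect to `g`, characterized by
`X g(Y, Z) = g(∇_X Y, Z) + g(Y, ∇̄_X Z)`, see `dual_spec`. It is built as
`∇̄_X Z = ∇_X Z + ((∇g)(X, Z, ·))♯`. -/
def dual (cov : CovariantDerivative I E (TangentSpace I : M → Type _)) :
    CovariantDerivative I E (TangentSpace I : M → Type _) :=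
  cov.addOneForm (dualCorrection cov)

theorem dual_spec (cov : CovariantDerivative I E (TangentSpace I : M → Type _))
    {Y Z : Π x : M, TangentSpace I x} {x : M}
    (hY : MDiffAt (T% Y) x) (hZ : MDiffAt (T% Z) x) (v : TangentSpace I x) :
    d% (fun y ↦ inner ℝ (Y y) (Z y)) x v =
      inner ℝ (cov Y x v) (Z x) + inner ℝ (Y x) (dual cov Z x v) := by
  have h1 : dual cov Z x v =
      cov Z x v + sharp x (cubicFormLast cov x v (Z x)) := rfl
  have h2 : cubicFormLast cov x v (Z x) (Y x) =
      d% (fun y ↦ inner ℝ (Z y) (Y y)) x v - inner ℝ (cov Z x v) (Y x)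
        - inner ℝ (Z x) (cov Y x v) := by
    have h3 := CovariantDerivative.derivMetricTensor_apply
      (V := fun x : M ↦ TangentSpace I x) cov (X := FiberBundle.extend E v) x hZ hY
    simpa [cubicFormLast, cubicForm] using h3
  have h4 : (fun y ↦ inner ℝ (Z y) (Y y)) = fun y ↦ inner ℝ (Y y) (Z y) := by
    funext y
    exact real_inner_comm _ _
  rw [h1, inner_add_right, inner_sharp, h2, h4,
    real_inner_comm (Y x) (cov Z x v), real_inner_comm (Z x) (cov Y x v)]
  ring

/-- A statistical structure is conjugate symmetric if `∇` and its dual connection have the same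
curvature tensor. -/
def IsConjugateSymmetric (cov : CovariantDerivative I E (TangentSpace I : M → Type _)) : Prop :=
  ∀ X Y Z : (Π x : M, TangentSpace I x), CMDiff ∞ (T% X) → CMDiff ∞ (T% Y) → CMDiff ∞ (T% Z) →
    ∀ x : M, curvature cov.toFun X Y Z x = curvature (dual cov).toFun X Y Z x

end Riemannian

end

end StatGeom

/-!
In a chart, let `ρ` be a 1-form such that `∇ + ρ` is flat. Its Schouten form
`S(u, w) = (∇_u ρ)(w) - ρ(u) ρ(w)` then determines the curvature:
`R(u, v)w = S(v, w) u - S(u, w) v - (S(u, v) - S(v, u)) w`. Duality and `R = R̄` make `R(u, v)`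
skew for `g`, which forces `S = k g` for a function `k`, so that
`R(u, v)w = k (g(v, w) u - g(u, w) v)`. In dimension at least two, differentiating `S = k g` and
using the Codazzi equation shows that `k` is locally constant, as in Schur's lemma.

The dual connection has the same curvature and satisfies the Codazzi equation as well. For constant
`k`, these are exactly the integrability conditions of the linear total differential equation
`df = α`, `∇̄α = - k f g`. Near a point, the solution with `f = 1` and `α = 0` there gives
`ρ' = - f⁻¹ df`, whose Schouten form with respect to `∇̄` is again `k g`; hence `∇̄ + ρ'` is flat.
In dimension at most one every connection is flat.
-/

namespace StatGeom

section Frobenius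

set_option maxSynthPendingDepth 3

variable {E F : Type*} [NormedAddCommGroup E] [NormedSpace ℝ E]
  [NormedAddCommGroup F] [NormedSpace ℝ F]

/-- Integrability at `y` of the total differential equation `ds = A s`, where `A y v : F → F` is the
coefficient in the direction `v`: the second derivative `(D_u A) v s + A v (A u s)` of a solution
has to be symmetric in `u` and `v`. Equivalently, the connection `d - A` has zero curvature. -/
def IsIntegrableSystemAt (A : E → E →L[ℝ] F →L[ℝ] F) (y : E) : Prop :=
  ∀ u v s, fderiv ℝ A y u v s + A y v (A y u s) = fderiv ℝ A y v u s + A y u (A y v s)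

/-- Uniform bounds on `A` and on its Taylor remainders of orders one and two over `S`, all with the
same constant `K`. -/
structure HasTaylorBoundsOn (A : E → F) (K : ℝ) (S : Set E) : Prop where
  differentiableAt : ∀ x ∈ S, DifferentiableAt ℝ A x
  norm_le : ∀ x ∈ S, ‖A x‖ ≤ K
  norm_sub_le : ∀ x ∈ S, ∀ y ∈ S, ‖A y - A x‖ ≤ K * ‖y - x‖
  norm_sub_sub_fderiv_le : ∀ x ∈ S, ∀ y ∈ S,
    ‖A y - A x - fderiv ℝ A x (y - x)‖ ≤ K * ‖y - x‖ ^ 2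

/-- `u` solves the restriction of `ds = A s` to the segment from `q` to `q + h`, with `u 0 = s₀`. -/
structure IsRadialSolution (A : E → E →L[ℝ] F →L[ℝ] F) (q : E) (s₀ : F) (h : E) (u : ℝ → F) :
    Prop where
  apply_zero : u 0 = s₀
  hasDerivWithinAt : ∀ t ∈ Icc (0 : ℝ) 1,
    HasDerivWithinAt u (A (q + t • h) h (u t)) (Icc 0 1) t

lemma norm_sub_sub_fderiv_le {f : E → F} {S : Set E} (hS : Convex ℝ S)
    (hf : ∀ x ∈ S, DifferentiableAt ℝ f x) {K : NNReal} (hK : LipschitzOnWith K (fderiv ℝ f) S)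
    {x y : E} (hx : x ∈ S) (hy : y ∈ S) :
    ‖f y - f x - fderiv ℝ f x (y - x)‖ ≤ K * ‖y - x‖ ^ 2 := by
  have hsub : segment ℝ x y ⊆ S := hS.segment_subset hx hy
  have hbound : ∀ z ∈ segment ℝ x y, ‖fderiv ℝ f z - fderiv ℝ f x‖ ≤ K * ‖y - x‖ := by
    intro z hz
    refine (hK.norm_sub_le (hsub hz) hx).trans ?_
    gcongr
    exact norm_sub_le_of_mem_segment hz
  have h := (convex_segment (𝕜 := ℝ) x y).norm_image_sub_le_of_norm_hasFDerivWithin_le'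
    (fun z hz ↦ (hf z (hsub hz)).hasFDerivAt.hasFDerivWithinAt) hbound
    (left_mem_segment ℝ x y) (right_mem_segment ℝ x y)
  rwa [mul_assoc, ← pow_two] at h

lemma exists_hasTaylorBoundsOn_ball {A : E → F} {q : E} (hA : ContDiffAt ℝ 2 A q) :
    ∃ K > 0, ∀ᶠ r in 𝓝[>] (0 : ℝ), HasTaylorBoundsOn A K (Metric.ball q r) := by
  obtain ⟨K₁, t₁, ht₁, h₁⟩ := (hA.of_le (m := 1) one_le_two).exists_lipschitzOnWith
  obtain ⟨K₂, t₂, ht₂, h₂⟩ :=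
    (hA.fderiv_right (m := 1) one_add_one_eq_two.le).exists_lipschitzOnWith
  have ht₃ : ∀ᶠ x in 𝓝 q, ‖A x‖ < ‖A q‖ + 1 :=
    hA.continuousAt.norm.eventually_lt_const (lt_add_one _)
  have ht₄ : ∀ᶠ x in 𝓝 q, DifferentiableAt ℝ A x :=
    (hA.eventually (by simp)).mono fun x hx ↦ hx.differentiableAt two_ne_zero
  obtain ⟨r₀, hr₀, hball⟩ := Metric.eventually_nhds_iff_ball.1
    (ht₃.and (ht₄.and (Filter.inter_mem ht₁ ht₂)))
  refine ⟨‖A q‖ + 1 + K₁ + K₂, by positivity, ?_⟩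
  filter_upwards [Ioo_mem_nhdsGT hr₀] with r hr
  replace hball := fun x hx ↦ hball x (Metric.ball_subset_ball hr.2.le hx)
  have hA₀ := norm_nonneg (A q)
  refine ⟨fun x hx ↦ (hball x hx).2.1, fun x hx ↦ ?_, fun x hx y hy ↦ ?_, fun x hx y hy ↦ ?_⟩
  · linarith [(hball x hx).1, K₁.coe_nonneg, K₂.coe_nonneg]
  · refine (h₁.norm_sub_le (hball y hy).2.2.1 (hball x hx).2.2.1).trans ?_
    gcongr
    linarith [K₂.coe_nonneg]
  · refine (norm_sub_sub_fderiv_le (convex_ball q r) (fun z hz ↦ (hball z hz).2.1)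
      (h₂.mono fun z hz ↦ (hball z hz).2.2.2) hx hy).trans ?_
    gcongr
    linarith [K₁.coe_nonneg]

lemma exists_solution_linear_ode [CompleteSpace F] {B : ℝ → F →L[ℝ] F}
    (hB : ContinuousOn B (Icc 0 1)) (hb : ∀ t ∈ Icc (0 : ℝ) 1, ‖B t‖ ≤ 1 / 2) (s₀ : F) :
    ∃ u : ℝ → F, u 0 = s₀ ∧
      ∀ t ∈ Icc (0 : ℝ) 1, HasDerivWithinAt u (B t (u t)) (Icc 0 1) t := by
  have hPL : IsPicardLindelof (fun t x ↦ B t x) (tmin := 0) (tmax := 1)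
      (⟨0, by simp⟩ : Icc (0 : ℝ) 1) s₀ (‖s₀‖₊ + 1) 0 (‖s₀‖₊ + 1) (1 / 2) := by
    refine ⟨fun t ht ↦ ?_, fun x _ ↦ hB.clm_apply continuousOn_const, fun t ht x hx ↦ ?_, by simp⟩
    · refine ((B t).lipschitz.weaken ?_).lipschitzOnWith
      exact_mod_cast hb t ht
    · have hBx := (B t).le_of_opNorm_le (hb t ht) x
      have hx₀ : ‖x - s₀‖ ≤ ‖s₀‖ + 1 := by simpa [dist_eq_norm] using hx
      have := norm_le_norm_add_norm_sub' x s₀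
      push_cast
      linarith
  simpa using hPL.exists_eq_forall_mem_Icc_hasDerivWithinAt₀

lemma gronwallBound_zero_one_le {L D : ℝ} (hL : 0 ≤ L) (hD : 0 ≤ D) :
    gronwallBound 0 L D 1 ≤ D * Real.exp L := by
  rcases hL.eq_or_lt with rfl | hL
  · simp [gronwallBound_K0]
  · have hexp : Real.exp L - 1 ≤ L * Real.exp L := by
      have := mul_le_mul_of_nonneg_right (Real.one_sub_le_exp_neg L) (Real.exp_pos L).le
      rw [← Real.exp_add, neg_add_cancel, Real.exp_zero] at this
      linarith
    calc gronwallBound 0 L D 1 = D / L * (Real.exp L - 1) := by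
          simp [gronwallBound_of_K_ne_0 hL.ne']
      _ ≤ D / L * (L * Real.exp L) := by gcongr
      _ = D * Real.exp L := by field_simp

lemma hasDerivWithinAt_Ici_of_Icc {f : ℝ → F} {f' : F} {a b t : ℝ} (ht : t ∈ Ico a b)
    (hf : HasDerivWithinAt f f' (Icc a b) t) : HasDerivWithinAt f f' (Ici t) t :=
  (hf.mono (Icc_subset_Icc_left ht.1)).mono_of_mem_nhdsWithin (Icc_mem_nhdsGE ht.2)

lemma add_smul_mem_ball {q h : E} {r t : ℝ} (hh : q + h ∈ Metric.ball q r)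
    (ht : t ∈ Icc (0 : ℝ) 1) : q + t • h ∈ Metric.ball q r :=
  (convex_ball q r).add_smul_mem
    (Metric.mem_ball_self (Metric.pos_of_mem_ball hh)) hh ht

section Radial

variable {A : E → E →L[ℝ] F →L[ℝ] F} {q h w : E} {s₀ : F} {r K : ℝ} {u u₁ u₂ : ℝ → F}

lemma IsRadialSolution.continuousOn (hu : IsRadialSolution A q s₀ h u) :
    ContinuousOn u (Icc 0 1) :=
  fun t ht ↦ (hu.hasDerivWithinAt t ht).continuousWithinAt

lemma IsRadialSolution.apply_one_of_zero (hu : IsRadialSolution A q s₀ 0 u) : u 1 = s₀ := by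
  have hconst : ∀ t ∈ Ico (0 : ℝ) 1, HasDerivWithinAt u 0 (Ici t) t := fun t ht ↦ by
    simpa using hasDerivWithinAt_Ici_of_Icc ht (hu.hasDerivWithinAt t (Ico_subset_Icc_self ht))
  rw [← hu.apply_zero]
  exact constant_of_has_deriv_right_zero hu.continuousOn hconst 1 (right_mem_Icc.2 zero_le_one)

lemma HasTaylorBoundsOn.exists_isRadialSolution [CompleteSpace F]
    (hA : HasTaylorBoundsOn A K (Metric.ball q r)) (hKr : K * r ≤ 1 / 2)
    (hh : q + h ∈ Metric.ball q r) (s₀ : F) : ∃ u, IsRadialSolution A q s₀ h u := by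
  have hcont : ContinuousOn (fun t : ℝ ↦ A (q + t • h)) (Icc 0 1) := fun t ht ↦
    ((hA.differentiableAt _ (add_smul_mem_ball hh ht)).continuousAt.comp
      (f := fun t : ℝ ↦ q + t • h) (by fun_prop)).continuousWithinAt
  have hnorm : ‖h‖ ≤ r := by simpa using (Metric.mem_ball.1 hh).le
  obtain ⟨u, hu₀, hu⟩ := exists_solution_linear_ode (B := fun t ↦ A (q + t • h) h)
    (hcont.clm_apply continuousOn_const) (fun t ht ↦ (ContinuousLinearMap.le_of_opNorm_le_of_le _
      (hA.norm_le _ (add_smul_mem_ball hh ht)) hnorm).trans hKr) s₀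
  exact ⟨u, hu₀, hu⟩

/-- First order guess, obtained from the solution `u` along the ray in the direction `h`, for the
solution along the ray in the direction `h + w`. -/
noncomputable def rayVariation (A : E → E →L[ℝ] F →L[ℝ] F) (q h w : E) (u : ℝ → F) (t : ℝ) : F :=
  u t + t • A (q + t • h) w (u t)

lemma IsRadialSolution.hasDerivWithinAt_rayVariation (hu : IsRadialSolution A q s₀ h u) {t : ℝ}
    (ht : t ∈ Icc (0 : ℝ) 1) (hA : DifferentiableAt ℝ A (q + t • h))
    (hint : IsIntegrableSystemAt A (q + t • h)) (w : E) :
    HasDerivWithinAt (rayVariation A q h w u)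
      (A (q + t • h) w (u t) + t • fderiv ℝ A (q + t • h) w h (u t) +
        A (q + t • h) h (rayVariation A q h w u t)) (Icc 0 1) t := by
  have hray : HasDerivAt (fun t : ℝ ↦ q + t • h) h t := by
    simpa using ((hasDerivAt_id t).smul_const h).const_add q
  have hAray : HasDerivAt (fun t : ℝ ↦ A (q + t • h)) (fderiv ℝ A (q + t • h) h) t :=
    hA.hasFDerivAt.comp_hasDerivAt t hray
  have hAw : HasDerivWithinAt (fun t : ℝ ↦ A (q + t • h) w) (fderiv ℝ A (q + t • h) h w)
      (Icc 0 1) t := by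
    simpa using (hAray.clm_apply (hasDerivAt_const t w)).hasDerivWithinAt
  have hut := hu.hasDerivWithinAt t ht
  refine (hut.add ((hasDerivWithinAt_id t (Icc 0 1)).smul
    (hAw.clm_apply hut))).congr_deriv ?_
  simp only [rayVariation, id, map_add, map_smul, eq_sub_of_add_eq (hint h w (u t))]
  module

lemma HasTaylorBoundsOn.norm_deriv_rayVariation_sub_le
    (hA : HasTaylorBoundsOn A K (Metric.ball q r)) (h₁ : q + h ∈ Metric.ball q r)
    (h₂ : q + (h + w) ∈ Metric.ball q r) {t N : ℝ} (ht : t ∈ Icc (0 : ℝ) 1) (hN : ‖u t‖ ≤ N) :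
    ‖A (q + t • h) w (u t) + t • fderiv ℝ A (q + t • h) w h (u t) +
        A (q + t • h) h (rayVariation A q h w u t) -
        A (q + t • (h + w)) (h + w) (rayVariation A q h w u t)‖ ≤
      K * (1 + K) * (1 + r) * N * ‖w‖ ^ 2 := by
  have hc := add_smul_mem_ball h₁ ht
  have hd := add_smul_mem_ball h₂ ht
  have hdc : q + t • (h + w) - (q + t • h) = t • w := by module
  set c := q + t • h
  set d := q + t • (h + w)
  have hh : ‖h‖ ≤ r := by simpa using (Metric.mem_ball.1 h₁).le
  have hK : 0 ≤ K := (norm_nonneg _).trans (hA.norm_le c hc)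
  have hdc_le : ‖d - c‖ ≤ ‖w‖ := by
    rw [hdc, norm_smul, Real.norm_of_nonneg ht.1]
    exact mul_le_of_le_one_left (norm_nonneg _) ht.2
  have hlip : ‖A d - A c‖ ≤ K * ‖w‖ := (hA.norm_sub_le c hc d hd).trans (by gcongr)
  have htaylor : ‖A d - A c - fderiv ℝ A c (d - c)‖ ≤ K * ‖w‖ ^ 2 :=
    (hA.norm_sub_sub_fderiv_le c hc d hd).trans (by gcongr)
  have hz : ‖t • A c w (u t)‖ ≤ K * ‖w‖ * N := by
    rw [norm_smul, Real.norm_of_nonneg ht.1]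
    exact (mul_le_of_le_one_left (norm_nonneg _) ht.2).trans
      (ContinuousLinearMap.le_of_opNorm₂_le_of_le _ (hA.norm_le c hc) le_rfl hN)
  have hsplit : A c w (u t) + t • fderiv ℝ A c w h (u t) + A c h (rayVariation A q h w u t) -
      A d (h + w) (rayVariation A q h w u t) =
      -((A d - A c - fderiv ℝ A c (d - c)) h (u t) + (A d - A c) h (t • A c w (u t)) +
        (A d - A c) w (u t) + A d w (t • A c w (u t))) := by
    simp only [rayVariation, hdc, map_add, map_smul, _root_.sub_apply, _root_.add_apply,
      _root_.smul_apply]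
    module
  rw [hsplit, norm_neg]
  refine (norm_add_le_of_le (norm_add_le_of_le (norm_add_le_of_le
    (ContinuousLinearMap.le_of_opNorm₂_le_of_le _ htaylor hh hN)
    (ContinuousLinearMap.le_of_opNorm₂_le_of_le _ hlip hh hz))
    (ContinuousLinearMap.le_of_opNorm₂_le_of_le _ hlip le_rfl hN))
    (ContinuousLinearMap.le_of_opNorm₂_le_of_le _ (hA.norm_le d hd) le_rfl hz)).trans_eq ?_
  ring

/-- Grönwall's inequality compares `u₂` with `rayVariation A q h w u₁`. -/
lemma IsRadialSolution.norm_apply_one_sub_le (hA : HasTaylorBoundsOn A K (Metric.ball q r))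
    (hint : ∀ y ∈ Metric.ball q r, IsIntegrableSystemAt A y)
    (h₁ : q + h ∈ Metric.ball q r) (h₂ : q + (h + w) ∈ Metric.ball q r)
    (hu₁ : IsRadialSolution A q s₀ h u₁) (hu₂ : IsRadialSolution A q s₀ (h + w) u₂)
    {N : ℝ} (hN : ∀ t ∈ Icc (0 : ℝ) 1, ‖u₁ t‖ ≤ N) :
    ‖u₂ 1 - u₁ 1 - A (q + h) w (u₁ 1)‖ ≤
      K * (1 + K) * (1 + r) * N * ‖w‖ ^ 2 * Real.exp (K * r) := by
  have hr : 0 ≤ r := (Metric.pos_of_mem_ball h₁).le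
  have hK : 0 ≤ K := (norm_nonneg _).trans (hA.norm_le _ h₁)
  have hN₀ : 0 ≤ N := (norm_nonneg _).trans (hN 0 (by simp))
  have hhw : ‖h + w‖ ≤ r := by simpa using (Metric.mem_ball.1 h₂).le
  have hv := fun t (ht : t ∈ Icc (0 : ℝ) 1) ↦ hu₁.hasDerivWithinAt_rayVariation ht
    (hA.differentiableAt _ (add_smul_mem_ball h₁ ht)) (hint _ (add_smul_mem_ball h₁ ht)) w
  have hlip : ∀ t ∈ Ico (0 : ℝ) 1,
      LipschitzOnWith (K * r).toNNReal (A (q + t • (h + w)) (h + w)) univ := fun t ht ↦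
    ((A (q + t • (h + w)) (h + w)).lipschitz.weaken <| NNReal.le_toNNReal_of_coe_le <|
      ContinuousLinearMap.le_of_opNorm_le_of_le _
        (hA.norm_le _ (add_smul_mem_ball h₂ (Ico_subset_Icc_self ht))) hhw).lipschitzOnWith
  have key := dist_le_of_approx_trajectories_ODE_of_mem
    (v := fun t ↦ A (q + t • (h + w)) (h + w)) (s := fun _ ↦ univ) (δ := 0) (εf := 0)
    (εg := K * (1 + K) * (1 + r) * N * ‖w‖ ^ 2) hlip hu₂.continuousOn
    (fun t ht ↦ hasDerivWithinAt_Ici_of_Icc ht (hu₂.hasDerivWithinAt t (Ico_subset_Icc_self ht)))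
    (by simp) (by simp) (fun t ht ↦ (hv t ht).continuousWithinAt)
    (fun t ht ↦ hasDerivWithinAt_Ici_of_Icc ht (hv t (Ico_subset_Icc_self ht)))
    (fun t ht ↦ by
      rw [dist_eq_norm]
      exact hA.norm_deriv_rayVariation_sub_le h₁ h₂ (Ico_subset_Icc_self ht)
        (hN t (Ico_subset_Icc_self ht)))
    (by simp) (by simp [rayVariation, hu₁.apply_zero, hu₂.apply_zero]) 1 (by simp)
  calc ‖u₂ 1 - u₁ 1 - A (q + h) w (u₁ 1)‖ = dist (u₂ 1) (rayVariation A q h w u₁ 1) := by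
        simp [rayVariation, dist_eq_norm, sub_sub]
    _ ≤ gronwallBound 0 (K * r) (K * (1 + K) * (1 + r) * N * ‖w‖ ^ 2) 1 := by
        simpa [Real.coe_toNNReal _ (mul_nonneg hK hr)] using key
    _ ≤ _ := gronwallBound_zero_one_le (by positivity) (by positivity)

lemma hasFDerivAt_of_isRadialSolution (hA : HasTaylorBoundsOn A K (Metric.ball q r))
    (hint : ∀ y ∈ Metric.ball q r, IsIntegrableSystemAt A y) {u : E → ℝ → F}
    (hu : ∀ y ∈ Metric.ball q r, IsRadialSolution A q s₀ (y - q) (u y)) {y : E}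
    (hy : y ∈ Metric.ball q r) :
    HasFDerivAt (fun y ↦ u y 1) ((A y).flip (u y 1)) y := by
  obtain ⟨N, hN⟩ := isCompact_Icc.exists_bound_of_continuousOn (hu y hy).continuousOn
  have hO : (fun z ↦ u z 1 - u y 1 - (A y).flip (u y 1) (z - y)) =O[𝓝 y] fun z ↦ ‖z - y‖ ^ 2 := by
    refine .of_bound (K * (1 + K) * (1 + r) * N * Real.exp (K * r)) ?_
    filter_upwards [Metric.isOpen_ball.mem_nhds hy] with z hz
    have hyz : y - q + (z - y) = z - q := by abel
    have hz' := hu z hz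
    rw [← hyz] at hz'
    have := (hu y hy).norm_apply_one_sub_le hA hint (by simpa using hy)
      (by simpa [hyz] using hz) hz' hN
    rw [add_sub_cancel] at this
    rw [ContinuousLinearMap.flip_apply, norm_pow, norm_norm]
    exact this.trans_eq (by ring)
  rw [hasFDerivAt_iff_isLittleO]
  exact hO.trans_isLittleO ((Asymptotics.isLittleO_norm_pow_id one_lt_two).comp_tendsto
    (tendsto_sub_nhds_zero_iff.2 Filter.tendsto_id))

end Radial

theorem exists_hasFDerivAt_of_isIntegrableSystemAt [CompleteSpace F] {A : E → E →L[ℝ] F →L[ℝ] F}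
    {q : E} (hA : ContDiffAt ℝ 2 A q) (hint : ∀ᶠ y in 𝓝 q, IsIntegrableSystemAt A y) (s₀ : F) :
    ∃ s : E → F, s q = s₀ ∧ ∀ᶠ y in 𝓝 q, HasFDerivAt s ((A y).flip (s y)) y := by
  obtain ⟨K, hK, hbounds⟩ := exists_hasTaylorBoundsOn_ball hA
  obtain ⟨r₀, hr₀, hint⟩ := Metric.eventually_nhds_iff_ball.1 hint
  obtain ⟨r, hA, hr⟩ := (hbounds.and
    (Ioo_mem_nhdsGT (lt_min hr₀ (by positivity : 0 < 1 / (2 * K))))).exists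
  have hKr : K * r ≤ 1 / 2 := by
    calc K * r ≤ K * (1 / (2 * K)) := by gcongr; exact hr.2.le.trans (min_le_right _ _)
      _ = 1 / 2 := by field_simp
  have hball : Metric.ball q r ⊆ Metric.ball q r₀ :=
    Metric.ball_subset_ball (hr.2.le.trans (min_le_left _ _))
  have hex : ∀ y : E, ∃ u, y ∈ Metric.ball q r → IsRadialSolution A q s₀ (y - q) u := by
    intro y
    by_cases hy : y ∈ Metric.ball q r
    · obtain ⟨u, hu⟩ := hA.exists_isRadialSolution hKr (h := y - q) (by simpa using hy) s₀
      exact ⟨u, fun _ ↦ hu⟩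
    · exact ⟨0, fun h ↦ absurd h hy⟩
  choose u hu using hex
  refine ⟨fun y ↦ u y 1, ?_, ?_⟩
  · have := hu q (Metric.mem_ball_self hr.1)
    rw [sub_self] at this
    exact this.apply_one_of_zero
  · filter_upwards [Metric.ball_mem_nhds q hr.1] with y hy
    exact hasFDerivAt_of_isRadialSolution hA (fun y hy ↦ hint y (hball hy)) hu hy

lemma contDiffOn_of_hasFDerivAt {n : ℕ∞} {A : E → E →L[ℝ] F →L[ℝ] F} {V : Set E}
    (hA : ContDiffOn ℝ n A V) {s : E → F}
    (hs : ∀ y ∈ V, HasFDerivAt s ((A y).flip (s y)) y) : ContDiffOn ℝ n s V := by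
  rw [contDiffOn_iff_forall_nat_le]
  intro m
  induction m with
  | zero => exact fun _ ↦ contDiffOn_zero.2 fun y hy ↦ (hs y hy).continuousAt.continuousWithinAt
  | succ m ih =>
    intro hm
    have hmn : (m : ℕ∞) ≤ n := le_trans (by exact_mod_cast m.le_succ) hm
    have hflip : ContDiffOn ℝ m (fun y ↦ (A y).flip) V :=
      (ContinuousLinearMap.flipₗᵢ ℝ E F F).toContinuousLinearEquiv.contDiff.comp_contDiffOn
        (hA.of_le (by exact_mod_cast hmn))
    push_cast
    rw [contDiffOn_succ_iff_hasFDerivWithinAt (by simp)]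
    intro y hy
    exact ⟨V, by rw [insert_eq_of_mem hy]; exact self_mem_nhdsWithin, by simp,
      fun y ↦ (A y).flip (s y), fun y hy ↦ (hs y hy).hasFDerivWithinAt, hflip.clm_apply (ih hmn)⟩

end Frobenius

section Calculus

set_option maxSynthPendingDepth 3

variable {E F G W : Type*} [NormedAddCommGroup E] [NormedSpace ℝ E] [NormedAddCommGroup F]
  [NormedSpace ℝ F] [NormedAddCommGroup G] [NormedSpace ℝ G] [NormedAddCommGroup W]
  [NormedSpace ℝ W] {y : E}

lemma fderiv_clm_apply_apply {B : E → F →L[ℝ] W} {P : E → F} (hB : DifferentiableAt ℝ B y)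
    (hP : DifferentiableAt ℝ P y) (u : E) :
    fderiv ℝ (fun z ↦ B z (P z)) y u = fderiv ℝ B y u (P y) + B y (fderiv ℝ P y u) := by
  rw [fderiv_clm_apply hB hP]
  simp [add_comm]

lemma fderiv_clm_apply_const {B : E → F →L[ℝ] W} (hB : DifferentiableAt ℝ B y) (a : F) (u : E) :
    fderiv ℝ (fun z ↦ B z a) y u = fderiv ℝ B y u a := by
  simp [fderiv_clm_apply_apply hB (differentiableAt_const a)]

lemma fderiv_clm_apply₂ {B : E → F →L[ℝ] G →L[ℝ] W} {P : E → F} {Q : E → G}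
    (hB : DifferentiableAt ℝ B y) (hP : DifferentiableAt ℝ P y) (hQ : DifferentiableAt ℝ Q y)
    (u : E) : fderiv ℝ (fun z ↦ B z (P z) (Q z)) y u =
      fderiv ℝ B y u (P y) (Q y) + B y (fderiv ℝ P y u) (Q y) + B y (P y) (fderiv ℝ Q y u) := by
  rw [fderiv_clm_apply_apply (hB.clm_apply hP) hQ, fderiv_clm_apply_apply hB hP]
  rfl

lemma fderiv_clm_apply₂_const {B : E → F →L[ℝ] G →L[ℝ] W} (hB : DifferentiableAt ℝ B y) (a : F)
    (b : G) (u : E) : fderiv ℝ (fun z ↦ B z a b) y u = fderiv ℝ B y u a b := by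
  simp [fderiv_clm_apply₂ hB (differentiableAt_const a) (differentiableAt_const b)]

lemma differentiableAt_clm_apply₂_const {B : E → F →L[ℝ] G →L[ℝ] W} (hB : DifferentiableAt ℝ B y)
    (a : F) (b : G) : DifferentiableAt ℝ (fun z ↦ B z a b) y :=
  (hB.clm_apply (differentiableAt_const a)).clm_apply (differentiableAt_const b)

lemma fderiv_apply_apply_comm {B : E → F →L[ℝ] F →L[ℝ] W} (hB : DifferentiableAt ℝ B y)
    (hsymm : ∀ᶠ z in 𝓝 y, ∀ a b, B z a b = B z b a) (u : E) (a b : F) :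
    fderiv ℝ B y u a b = fderiv ℝ B y u b a := by
  have hcongr : (fun z ↦ B z a b) =ᶠ[𝓝 y] fun z ↦ B z b a := hsymm.mono fun z hz ↦ hz a b
  rw [← fderiv_clm_apply₂_const hB, hcongr.fderiv_eq, fderiv_clm_apply₂_const hB]

lemma fderiv_fderiv_apply_comm {f : E → W} (hf : ContDiffAt ℝ 2 f y) (u v : E) :
    fderiv ℝ (fun z ↦ fderiv ℝ f z u) y v = fderiv ℝ (fun z ↦ fderiv ℝ f z v) y u := by
  have hd : DifferentiableAt ℝ (fderiv ℝ f) y :=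
    (hf.fderiv_right (m := 1) one_add_one_eq_two.le).differentiableAt one_ne_zero
  rw [fderiv_clm_apply_const hd, fderiv_clm_apply_const hd]
  exact (hf.isSymmSndFDerivAt (by simp)) v u

lemma contDiffOn_clm_apply₂ [FiniteDimensional ℝ F] [FiniteDimensional ℝ G]
    {B : E → F →L[ℝ] G →L[ℝ] W} {V : Set E} {n : WithTop ℕ∞} :
    ContDiffOn ℝ n B V ↔ ∀ a b, ContDiffOn ℝ n (fun y ↦ B y a b) V :=
  contDiffOn_clm_apply.trans (forall_congr' fun _ ↦ contDiffOn_clm_apply)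

end Calculus

section ChristoffelCurvature

set_option maxSynthPendingDepth 3

variable {E : Type*} [NormedAddCommGroup E] [NormedSpace ℝ E]
  {g : E → E →L[ℝ] E →L[ℝ] ℝ} {Γ : E → E →L[ℝ] E →L[ℝ] E} {ρ : E → E →L[ℝ] ℝ} {y : E}

/-- The curvature `R(u, v)w` at `y` of the connection with Christoffel symbols `Γ`; here `Γ y w u`
is the derivative at `y` of the constant vector field `w` in the direction `u`. -/
noncomputable def christoffelCurvature (Γ : E → E →L[ℝ] E →L[ℝ] E) (y u v w : E) : E :=
  fderiv ℝ Γ y u w v - fderiv ℝ Γ y v w u + Γ y (Γ y w v) u - Γ y (Γ y w u) v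

lemma christoffelCurvature_congr {Γ' : E → E →L[ℝ] E →L[ℝ] E} (h : Γ =ᶠ[𝓝 y] Γ') (u v w : E) :
    christoffelCurvature Γ y u v w = christoffelCurvature Γ' y u v w := by
  simp only [christoffelCurvature, h.fderiv_eq, h.eq_of_nhds]

lemma christoffelCurvature_eq_zero_of_finrank_le_one [FiniteDimensional ℝ E]
    (hE : Module.finrank ℝ E ≤ 1) (Γ : E → E →L[ℝ] E →L[ℝ] E) (y u v w : E) :
    christoffelCurvature Γ y u v w = 0 := by
  obtain ⟨e, he⟩ := finrank_le_one_iff.1 hE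
  obtain ⟨a, rfl⟩ := he u
  obtain ⟨b, rfl⟩ := he v
  simp only [christoffelCurvature, map_smul, _root_.smul_apply]
  module

/-- The symmetric bilinear map `(a, u) ↦ α(a) u + α(u) a`, as a function of the linear form `α`. -/
noncomputable def symmProd : (E →L[ℝ] ℝ) →L[ℝ] E →L[ℝ] E →L[ℝ] E :=
  ContinuousLinearMap.smulRightL ℝ E E +
    (ContinuousLinearMap.flipₗᵢ ℝ E E E).toContinuousLinearEquiv.toContinuousLinearMap ∘L
      ContinuousLinearMap.smulRightL ℝ E E

lemma symmProd_apply (α : E →L[ℝ] ℝ) (a u : E) : symmProd α a u = α a • u + α u • a :=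
  add_comm _ _

/-- The Christoffel symbols of `∇_X Y + ρ(X) Y + ρ(Y) X`, where `Γ` are those of `∇`. -/
noncomputable def projectiveChange (Γ : E → E →L[ℝ] E →L[ℝ] E) (ρ : E → E →L[ℝ] ℝ) :
    E → E →L[ℝ] E →L[ℝ] E :=
  fun y ↦ Γ y + symmProd (ρ y)

lemma projectiveChange_apply (Γ : E → E →L[ℝ] E →L[ℝ] E) (ρ : E → E →L[ℝ] ℝ) (y a u : E) :
    projectiveChange Γ ρ y a u = Γ y a u + (ρ y a • u + ρ y u • a) := by
  simp [projectiveChange, symmProd_apply]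

lemma contDiffAt_projectiveChange {n : WithTop ℕ∞} (hΓ : ContDiffAt ℝ n Γ y)
    (hρ : ContDiffAt ℝ n ρ y) : ContDiffAt ℝ n (projectiveChange Γ ρ) y :=
  hΓ.add ((symmProd (E := E)).contDiff.contDiffAt.comp y hρ)

/-- The bilinear form `(u, w) ↦ (∇_u ρ)(w) - ρ(u) ρ(w)`, which governs how the curvature changes
under the projective change by `ρ`. -/
noncomputable def schoutenForm (Γ : E → E →L[ℝ] E →L[ℝ] E) (ρ : E → E →L[ℝ] ℝ) (y : E) :
    E →L[ℝ] E →L[ℝ] ℝ :=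
  fderiv ℝ ρ y - (ContinuousLinearMap.compL ℝ E E ℝ (ρ y)) ∘L (Γ y).flip
    - (ρ y).smulRight (ρ y)

lemma schoutenForm_apply (Γ : E → E →L[ℝ] E →L[ℝ] E) (ρ : E → E →L[ℝ] ℝ) (y u w : E) :
    schoutenForm Γ ρ y u w = fderiv ℝ ρ y u w - ρ y (Γ y w u) - ρ y u * ρ y w := by
  simp [schoutenForm]

lemma differentiableAt_schoutenForm_apply (hΓ : DifferentiableAt ℝ Γ y) (hρ : ContDiffAt ℝ 2 ρ y)
    (u w : E) : DifferentiableAt ℝ (fun z ↦ schoutenForm Γ ρ z u w) y := by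
  have hdρ : DifferentiableAt ℝ (fderiv ℝ ρ) y :=
    (hρ.fderiv_right (m := 1) one_add_one_eq_two.le).differentiableAt one_ne_zero
  have hρy : DifferentiableAt ℝ ρ y := hρ.differentiableAt two_ne_zero
  have hρ_apply : ∀ a, DifferentiableAt ℝ (fun z ↦ ρ z a) y := fun a ↦
    hρy.clm_apply (differentiableAt_const a)
  simp only [schoutenForm_apply]
  exact ((differentiableAt_clm_apply₂_const hdρ u w).fun_sub
    (hρy.clm_apply (differentiableAt_clm_apply₂_const hΓ w u))).fun_sub
    ((hρ_apply u).fun_mul (hρ_apply w))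

lemma christoffelCurvature_projectiveChange (hΓ : DifferentiableAt ℝ Γ y)
    (hρ : DifferentiableAt ℝ ρ y) (hsymm : ∀ a b, Γ y a b = Γ y b a) (u v w : E) :
    christoffelCurvature (projectiveChange Γ ρ) y u v w = christoffelCurvature Γ y u v w
      + (schoutenForm Γ ρ y u v - schoutenForm Γ ρ y v u) • w
      + schoutenForm Γ ρ y u w • v - schoutenForm Γ ρ y v w • u := by
  have hsymmProd : HasFDerivAt (fun z ↦ symmProd (ρ z)) (symmProd ∘L fderiv ℝ ρ y) y :=
    HasFDerivAt.comp y (symmProd (E := E)).hasFDerivAt hρ.hasFDerivAt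
  have hderiv : fderiv ℝ (projectiveChange Γ ρ) y = fderiv ℝ Γ y + symmProd ∘L fderiv ℝ ρ y :=
    (hΓ.hasFDerivAt.fun_add hsymmProd).fderiv
  simp only [christoffelCurvature, hderiv, projectiveChange_apply, schoutenForm_apply, map_add,
    map_smul, _root_.add_apply, _root_.smul_apply, ContinuousLinearMap.comp_apply, symmProd_apply,
    hsymm u v]
  module

/-- The curvature at `y` of the Christoffel symbols `Γ` has the form that it has for a metric `g` of
constant sectional curvature `k`. -/
def HasSectionalCurvatureAt (g : E → E →L[ℝ] E →L[ℝ] ℝ) (Γ : E → E →L[ℝ] E →L[ℝ] E) (k : ℝ)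
    (y : E) : Prop :=
  ∀ u v w, christoffelCurvature Γ y u v w = k • (g y v w • u - g y u w • v)

lemma christoffelCurvature_projectiveChange_eq_zero_iff {k : ℝ} (hΓ : DifferentiableAt ℝ Γ y)
    (hρ : DifferentiableAt ℝ ρ y) (hsymm : ∀ a b, Γ y a b = Γ y b a)
    (hg : ∀ a b, g y a b = g y b a) (hS : ∀ u v, schoutenForm Γ ρ y u v = k * g y u v) :
    (∀ u v w, christoffelCurvature (projectiveChange Γ ρ) y u v w = 0) ↔
      HasSectionalCurvatureAt g Γ k y := by
  refine forall₃_congr fun u v w ↦ ?_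
  rw [christoffelCurvature_projectiveChange hΓ hρ hsymm, hS, hS, hS, hS, hg v u,
    ← sub_eq_zero (b := k • _)]
  congr! 1
  module

/-- Projective flatness near `q` of the connection with Christoffel symbols `Γ`. -/
def IsProjectivelyFlatAt (Γ : E → E →L[ℝ] E →L[ℝ] E) (q : E) : Prop :=
  ∃ ρ : E → E →L[ℝ] ℝ, ∀ᶠ y in 𝓝 q, ContDiffAt ℝ ∞ ρ y ∧
    ∀ u v w, christoffelCurvature (projectiveChange Γ ρ) y u v w = 0

end ChristoffelCurvature

section BilinearForm

variable {E : Type*} [NormedAddCommGroup E] [NormedSpace ℝ E] {g S : E →L[ℝ] E →L[ℝ] ℝ}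

lemma exists_apply_eq_mul_of_orthogonal_imp (hpos : ∀ a, a ≠ 0 → 0 < g a a)
    (h : ∀ a b, g a b = 0 → S a b = 0) : ∃ k, ∀ a b, S a b = k * g a b := by
  have left : ∀ a, a ≠ 0 → ∀ b, S a b = S a a / g a a * g a b := fun a ha b ↦ by
    have hga := (hpos a ha).ne'
    have := h a (b - (g a b / g a a) • a) (by simp [hga])
    simp only [map_sub, map_smul, smul_eq_mul] at this
    linear_combination this
  have right : ∀ b, b ≠ 0 → ∀ a, S a b = S b b / g b b * g a b := fun b hb a ↦ by
    have hgb := (hpos b hb).ne'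
    have := h (a - (g a b / g b b) • b) b (by simp [hgb])
    simp only [map_sub, map_smul, _root_.sub_apply, _root_.smul_apply, smul_eq_mul] at this
    linear_combination this
  have ratio_eq : ∀ a b, g a b ≠ 0 → S a a / g a a = S b b / g b b := fun a b hab ↦ by
    have ha : a ≠ 0 := by rintro rfl; simp at hab
    have hb : b ≠ 0 := by rintro rfl; simp at hab
    exact mul_right_cancel₀ hab ((left a ha b).symm.trans (right b hb a))
  rcases subsingleton_or_nontrivial E with _ | _
  · exact ⟨0, fun a b ↦ by simp [Subsingleton.elim a 0]⟩
  obtain ⟨e, he⟩ := exists_ne (0 : E)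
  refine ⟨S e e / g e e, fun a b ↦ ?_⟩
  rcases eq_or_ne a 0 with rfl | ha
  · simp
  suffices S a a / g a a = S e e / g e e by rw [left a ha, this]
  by_cases hae : g a e = 0
  · have haa := (hpos a ha).ne'
    have hee := (hpos e he).ne'
    exact (ratio_eq a (a + e) (by simpa [hae])).trans (ratio_eq (a + e) e (by simpa [hae]))
  · exact ratio_eq a e hae

lemma exists_apply_eq_mul_of_skew (hg : ∀ a b, g a b = g b a) (hpos : ∀ a, a ≠ 0 → 0 < g a a)
    (h : ∀ u v w, g ((S u v - S v u) • w + S u w • v - S v w • u) w = 0) :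
    ∃ k, ∀ a b, S a b = k * g a b := by
  -- For orthogonal `u` and `v`, skewness with `w = u` reads `S u v = 2 S v u`.
  have key : ∀ u v, g u v = 0 → u ≠ 0 → S u v = 2 * S v u := fun u v huv hu ↦ by
    have hskew := h u v u
    simp only [map_add, map_sub, map_smul, _root_.add_apply, _root_.sub_apply,
      _root_.smul_apply, smul_eq_mul, hg v u, huv] at hskew
    exact mul_right_cancel₀ (hpos u hu).ne' (by linear_combination hskew)
  refine exists_apply_eq_mul_of_orthogonal_imp hpos fun u v huv ↦ ?_
  rcases eq_or_ne u 0 with rfl | hu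
  · simp
  rcases eq_or_ne v 0 with rfl | hv
  · simp
  linarith [key u v huv hu, key v u (by rw [hg, huv]) hv]

end BilinearForm

section StatisticalStructure

set_option maxSynthPendingDepth 3

variable {E : Type*} [NormedAddCommGroup E] [NormedSpace ℝ E]
  {g : E → E →L[ℝ] E →L[ℝ] ℝ} {Γ Γ' : E → E →L[ℝ] E →L[ℝ] E} {ρ : E → E →L[ℝ] ℝ}
  {V : Set E} {q y : E}

/-- A smooth Riemannian metric on an open subset `V` of a vector space. -/
structure IsRiemannianMetricOn (g : E → E →L[ℝ] E →L[ℝ] ℝ) (V : Set E) : Prop where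
  isOpen : IsOpen V
  contDiffOn_metric : ContDiffOn ℝ ∞ g V
  metric_symm : ∀ y ∈ V, ∀ a b, g y a b = g y b a
  metric_pos : ∀ y ∈ V, ∀ a, a ≠ 0 → 0 < g y a a

/-- A statistical structure `(g, ∇)` on an open subset `V` of a vector space, where `Γ` are the
Christoffel symbols of `∇`. The total symmetry of `∇g` is expressed by the Codazzi equation. -/
structure IsStatisticalOn (g : E → E →L[ℝ] E →L[ℝ] ℝ) (Γ : E → E →L[ℝ] E →L[ℝ] E) (V : Set E) :
    Prop extends IsRiemannianMetricOn g V where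
  contDiffOn : ContDiffOn ℝ ∞ Γ V
  symm : ∀ y ∈ V, ∀ a b, Γ y a b = Γ y b a
  codazzi : ∀ y ∈ V, ∀ u v z,
    fderiv ℝ g y v u z + g y v (Γ y z u) = fderiv ℝ g y u v z + g y u (Γ y z v)

/-- A pair of torsion-free connections on an open subset `V` of a vector space, given by their
Christoffel symbols, which are dual with respect to the Riemannian metric `g` and have the same
curvature. -/
structure IsConjugatePairOn (g : E → E →L[ℝ] E →L[ℝ] ℝ) (Γ Γ' : E → E →L[ℝ] E →L[ℝ] E)
    (V : Set E) : Prop extends IsRiemannianMetricOn g V where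
  contDiffOn : ContDiffOn ℝ ∞ Γ V
  contDiffOn' : ContDiffOn ℝ ∞ Γ' V
  symm : ∀ y ∈ V, ∀ a b, Γ y a b = Γ y b a
  symm' : ∀ y ∈ V, ∀ a b, Γ' y a b = Γ' y b a
  compat : ∀ y ∈ V, ∀ u a b, fderiv ℝ g y u a b = g y (Γ y a u) b + g y a (Γ' y b u)
  curvature_eq : ∀ y ∈ V, ∀ u v w, christoffelCurvature Γ y u v w = christoffelCurvature Γ' y u v w

namespace IsRiemannianMetricOn

lemma differentiableAt_metric (h : IsRiemannianMetricOn g V) (hy : y ∈ V) :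
    DifferentiableAt ℝ g y :=
  (h.contDiffOn_metric.contDiffAt (h.isOpen.mem_nhds hy)).differentiableAt (by simp)

lemma fderiv_metric_symm (h : IsRiemannianMetricOn g V) (hy : y ∈ V) (u a b : E) :
    fderiv ℝ g y u a b = fderiv ℝ g y u b a :=
  fderiv_apply_apply_comm (h.differentiableAt_metric hy)
    (Filter.eventually_of_mem (h.isOpen.mem_nhds hy) h.metric_symm) u a b

end IsRiemannianMetricOn

namespace IsStatisticalOn

lemma differentiableAt (h : IsStatisticalOn g Γ V) (hy : y ∈ V) : DifferentiableAt ℝ Γ y :=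
  (h.contDiffOn.contDiffAt (h.isOpen.mem_nhds hy)).differentiableAt (by simp)

lemma fderiv_symm (h : IsStatisticalOn g Γ V) (hy : y ∈ V) (u a b : E) :
    fderiv ℝ Γ y u a b = fderiv ℝ Γ y u b a :=
  fderiv_apply_apply_comm (h.differentiableAt hy)
    (Filter.eventually_of_mem (h.isOpen.mem_nhds hy) h.symm) u a b

end IsStatisticalOn

namespace IsConjugatePairOn

lemma swap (h : IsConjugatePairOn g Γ Γ' V) : IsConjugatePairOn g Γ' Γ V where
  toIsRiemannianMetricOn := h.toIsRiemannianMetricOn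
  contDiffOn := h.contDiffOn'
  contDiffOn' := h.contDiffOn
  symm := h.symm'
  symm' := h.symm
  compat y hy u a b := by
    rw [h.fderiv_metric_symm hy, h.compat y hy, h.metric_symm y hy b, h.metric_symm y hy _ a,
      add_comm]
  curvature_eq y hy u v w := (h.curvature_eq y hy u v w).symm

lemma isStatisticalOn (h : IsConjugatePairOn g Γ Γ' V) : IsStatisticalOn g Γ V where
  toIsRiemannianMetricOn := h.toIsRiemannianMetricOn
  contDiffOn := h.contDiffOn
  symm := h.symm
  codazzi y hy u v z := by
    rw [h.fderiv_metric_symm hy v u z, h.fderiv_metric_symm hy u v z, h.compat y hy,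
      h.compat y hy, h.symm' y hy u v, h.metric_symm y hy v, h.metric_symm y hy u]
    ring

lemma fderiv_fderiv_metric (h : IsConjugatePairOn g Γ Γ' V) (hy : y ∈ V) (u v a b : E) :
    fderiv ℝ (fun z ↦ fderiv ℝ (fun z ↦ g z a b) z u) y v =
      g y (Γ y (Γ y a u) v) b + g y (Γ y a u) (Γ' y b v) + g y (fderiv ℝ Γ y v a u) b
      + (g y (Γ y a v) (Γ' y b u) + g y a (Γ' y (Γ' y b u) v) + g y a (fderiv ℝ Γ' y v b u)) := by
  have hg := h.differentiableAt_metric hy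
  have hΓ := h.isStatisticalOn.differentiableAt hy
  have hΓ' := h.swap.isStatisticalOn.differentiableAt hy
  have hau := differentiableAt_clm_apply₂_const hΓ a u
  have hbu := differentiableAt_clm_apply₂_const hΓ' b u
  have hcompat : (fun z ↦ fderiv ℝ (fun z ↦ g z a b) z u) =ᶠ[𝓝 y]
      fun z ↦ g z (Γ z a u) b + g z a (Γ' z b u) := by
    filter_upwards [h.isOpen.mem_nhds hy] with z hz
    rw [fderiv_clm_apply₂_const (h.differentiableAt_metric hz), h.compat z hz]
  rw [hcompat.fderiv_eq, fderiv_fun_add ((hg.clm_apply hau).clm_apply (differentiableAt_const b))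
      ((hg.clm_apply (differentiableAt_const a)).clm_apply hbu), _root_.add_apply,
    fderiv_clm_apply₂ hg hau (differentiableAt_const b),
    fderiv_clm_apply₂ hg (differentiableAt_const a) hbu,
    fderiv_clm_apply₂_const hΓ, fderiv_clm_apply₂_const hΓ', h.compat y hy, h.compat y hy]
  simp

lemma metric_curvature (h : IsConjugatePairOn g Γ Γ' V) (hy : y ∈ V) (u v a b : E) :
    g y (christoffelCurvature Γ y u v a) b + g y a (christoffelCurvature Γ y u v b) = 0 := by
  have hg : ContDiffAt ℝ 2 (fun z ↦ g z a b) y :=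
    (((h.contDiffOn_metric.contDiffAt (h.isOpen.mem_nhds hy)).clm_apply
      contDiffAt_const).clm_apply contDiffAt_const).of_le (by norm_cast)
  have hcomm := fderiv_fderiv_apply_comm hg u v
  rw [h.fderiv_fderiv_metric hy, h.fderiv_fderiv_metric hy] at hcomm
  rw [h.curvature_eq y hy u v b]
  simp only [christoffelCurvature, map_add, map_sub, _root_.add_apply, _root_.sub_apply]
  linarith

lemma exists_schoutenForm_eq (h : IsConjugatePairOn g Γ Γ' V) (hy : y ∈ V)
    (hρ : DifferentiableAt ℝ ρ y)
    (hflat : ∀ u v w, christoffelCurvature (projectiveChange Γ ρ) y u v w = 0) :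
    ∃ k, ∀ u v, schoutenForm Γ ρ y u v = k * g y u v := by
  refine exists_apply_eq_mul_of_skew (h.metric_symm y hy) (h.metric_pos y hy) fun u v w ↦ ?_
  have hskew := h.metric_curvature hy u v w w
  have hzero := congrArg (g y · w) ((christoffelCurvature_projectiveChange
    (h.isStatisticalOn.differentiableAt hy) hρ (h.symm y hy) u v w).symm.trans (hflat u v w))
  simp only [map_zero, map_add, map_sub, _root_.add_apply, _root_.sub_apply,
    _root_.zero_apply] at hzero ⊢
  linarith [h.metric_symm y hy w (christoffelCurvature Γ y u v w)]

end IsConjugatePairOn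

section Schur

namespace IsStatisticalOn

lemma fderiv_fderiv_of_schoutenForm_eq (h : IsStatisticalOn g Γ V) (hy : y ∈ V) {k : E → ℝ}
    (hk : DifferentiableAt ℝ k y) (hρ : ∀ᶠ z in 𝓝 y, DifferentiableAt ℝ ρ z)
    (hS : ∀ᶠ z in 𝓝 y, ∀ u v, schoutenForm Γ ρ z u v = k z * g z u v) (u v w : E) :
    fderiv ℝ (fun z ↦ fderiv ℝ (fun z ↦ ρ z w) z u) y v =
      fderiv ℝ ρ y v (Γ y w u) + ρ y (fderiv ℝ Γ y v w u)
      + (fderiv ℝ ρ y v u * ρ y w + ρ y u * fderiv ℝ ρ y v w)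
      + (fderiv ℝ k y v * g y u w + k y * fderiv ℝ g y v u w) := by
  have hg := h.differentiableAt_metric hy
  have hΓ := h.differentiableAt hy
  have hρy := hρ.self_of_nhds
  have hfderiv : (fun z ↦ fderiv ℝ (fun z ↦ ρ z w) z u) =ᶠ[𝓝 y]
      fun z ↦ ρ z (Γ z w u) + ρ z u * ρ z w + k z * g z u w := by
    filter_upwards [hρ, hS] with z hρz hSz
    rw [fderiv_clm_apply_const hρz, ← hSz, schoutenForm_apply]
    ring
  have hwu := differentiableAt_clm_apply₂_const hΓ w u
  have hρu : ∀ u, DifferentiableAt ℝ (fun z ↦ ρ z u) y := fun u ↦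
    hρy.clm_apply (differentiableAt_const u)
  have hguw := differentiableAt_clm_apply₂_const hg u w
  rw [hfderiv.fderiv_eq, fderiv_fun_add ((hρy.clm_apply hwu).fun_add ((hρu u).fun_mul (hρu w)))
      (hk.fun_mul hguw), fderiv_fun_add (hρy.clm_apply hwu) ((hρu u).fun_mul (hρu w)),
    fderiv_fun_mul (hρu u) (hρu w), fderiv_fun_mul hk hguw]
  simp only [_root_.add_apply, _root_.smul_apply, smul_eq_mul]
  rw [fderiv_clm_apply_apply hρy hwu, fderiv_clm_apply₂_const hΓ, fderiv_clm_apply₂_const hg,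
    fderiv_clm_apply_const hρy, fderiv_clm_apply_const hρy]
  ring

lemma fderiv_mul_metric_comm (h : IsStatisticalOn g Γ V) (hy : y ∈ V) {k : E → ℝ}
    (hk : DifferentiableAt ℝ k y) (hρ : ContDiffAt ℝ 2 ρ y)
    (hS : ∀ᶠ z in 𝓝 y, ∀ u v, schoutenForm Γ ρ z u v = k z * g z u v)
    (hcurv : HasSectionalCurvatureAt g Γ (k y) y) (u v w : E) :
    fderiv ℝ k y v * g y u w = fderiv ℝ k y u * g y v w := by
  have hρ_near : ∀ᶠ z in 𝓝 y, DifferentiableAt ℝ ρ z :=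
    (hρ.eventually (by simp)).mono fun z hz ↦ hz.differentiableAt (by simp)
  have hderiv : ∀ u w, fderiv ℝ ρ y u w = ρ y (Γ y w u) + ρ y u * ρ y w + k y * g y u w :=
    fun u w ↦ by linear_combination hS.self_of_nhds u w - schoutenForm_apply Γ ρ y u w
  have hcomm := fderiv_fderiv_apply_comm (hρ.clm_apply (contDiffAt_const (c := w))) u v
  rw [h.fderiv_fderiv_of_schoutenForm_eq hy hk hρ_near hS,
    h.fderiv_fderiv_of_schoutenForm_eq hy hk hρ_near hS] at hcomm
  simp only [hderiv, h.symm y hy v u, h.metric_symm y hy v u] at hcomm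
  have hρcurv := congrArg (ρ y) (hcurv v u w)
  simp only [christoffelCurvature, map_add, map_sub, map_smul, smul_eq_mul] at hρcurv
  linear_combination hcomm - hρcurv - k y * h.codazzi y hy u v w

lemma fderiv_eq_zero_of_schoutenForm_eq [FiniteDimensional ℝ E] (hE : 1 < Module.finrank ℝ E)
    (h : IsStatisticalOn g Γ V) (hy : y ∈ V) {k : E → ℝ} (hk : DifferentiableAt ℝ k y)
    (hρ : ContDiffAt ℝ 2 ρ y)
    (hS : ∀ᶠ z in 𝓝 y, ∀ u v, schoutenForm Γ ρ z u v = k z * g z u v)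
    (hcurv : HasSectionalCurvatureAt g Γ (k y) y) : fderiv ℝ k y = 0 := by
  ext v
  obtain ⟨u, hvu, hu⟩ := (Submodule.ne_bot_iff _).1 (LinearMap.ker_ne_bot_of_finrank_lt
    (f := (g y v).toLinearMap) (by simpa using hE))
  have hcomm := h.fderiv_mul_metric_comm hy hk hρ hS hcurv u v u
  rw [show g y v u = 0 from hvu, mul_zero] at hcomm
  simpa using (mul_eq_zero.1 hcomm).resolve_right (h.metric_pos y hy u hu).ne'

theorem exists_eventually_hasSectionalCurvatureAt [FiniteDimensional ℝ E]
    (hE : 1 < Module.finrank ℝ E) (h : IsStatisticalOn g Γ V) (hq : q ∈ V)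
    (hρ : ∀ᶠ y in 𝓝 q, ContDiffAt ℝ 2 ρ y)
    (hS : ∀ᶠ y in 𝓝 q, ∃ k, ∀ u v, schoutenForm Γ ρ y u v = k * g y u v)
    (hflat : ∀ᶠ y in 𝓝 q, ∀ u v w, christoffelCurvature (projectiveChange Γ ρ) y u v w = 0) :
    ∃ k, ∀ᶠ y in 𝓝 q, HasSectionalCurvatureAt g Γ k y := by
  have : Nontrivial E := Module.nontrivial_of_finrank_pos (R := ℝ) (by omega)
  obtain ⟨e, he⟩ := exists_ne (0 : E)
  let k : E → ℝ := fun y ↦ schoutenForm Γ ρ y e e / g y e e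
  obtain ⟨r, hr, hball⟩ := Metric.eventually_nhds_iff_ball.1
    ((h.isOpen.eventually_mem hq).and (hρ.and (hS.and hflat)))
  have hSk : ∀ y ∈ Metric.ball q r, ∀ u v, schoutenForm Γ ρ y u v = k y * g y u v := by
    intro y hy u v
    obtain ⟨hyV, -, ⟨c, hc⟩, -⟩ := hball y hy
    simp only [k, hc]
    rw [mul_div_cancel_right₀ _ (h.metric_pos y hyV e he).ne']
  have hcurv : ∀ y ∈ Metric.ball q r, HasSectionalCurvatureAt g Γ (k y) y := by
    intro y hy
    obtain ⟨hyV, hρy, -, hflaty⟩ := hball y hy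
    exact (christoffelCurvature_projectiveChange_eq_zero_iff (h.differentiableAt hyV)
      (hρy.differentiableAt (by simp)) (h.symm y hyV) (h.metric_symm y hyV) (hSk y hy)).1 hflaty
  have hk : ∀ y ∈ Metric.ball q r, DifferentiableAt ℝ k y := by
    intro y hy
    obtain ⟨hyV, hρy, -, -⟩ := hball y hy
    simp only [k, div_eq_mul_inv]
    exact (differentiableAt_schoutenForm_apply (h.differentiableAt hyV) hρy e e).fun_mul
      ((differentiableAt_clm_apply₂_const (h.differentiableAt_metric hyV) e e).fun_inv
        (h.metric_pos y hyV e he).ne')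
  refine ⟨k q, Filter.eventually_of_mem (Metric.ball_mem_nhds q hr) fun y hy ↦ ?_⟩
  rw [← Metric.isOpen_ball.is_const_of_fderiv_eq_zero (convex_ball q r).isPreconnected
    (fun z hz ↦ (hk z hz).differentiableWithinAt) (fun z hz ↦
      h.fderiv_eq_zero_of_schoutenForm_eq hE (hball z hz).1 (hk z hz) (hball z hz).2.1
        (Filter.eventually_of_mem (Metric.isOpen_ball.mem_nhds hz) hSk) (hcurv z hz))
    hy (Metric.mem_ball_self hr)]
  exact hcurv y hy

end IsStatisticalOn

end Schur

section HessianSystem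

lemma schoutenForm_neg_inv_smul {f : E → ℝ} {α : E → E →L[ℝ] ℝ} {α' : E →L[ℝ] E →L[ℝ] ℝ}
    {k : ℝ} (hf : HasFDerivAt f (α y) y) (hα : HasFDerivAt α α' y)
    (hα' : ∀ u w, α' u w = α y (Γ y w u) - k * f y * g y u w) (hfy : f y ≠ 0) (u w : E) :
    schoutenForm Γ (fun z ↦ -((f z)⁻¹ • α z)) y u w = k * g y u w := by
  have hρ : HasFDerivAt (fun z ↦ -((f z)⁻¹ • α z)) _ y :=
    (((hasDerivAt_inv hfy).comp_hasFDerivAt y hf).fun_smul hα).fun_neg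
  rw [schoutenForm_apply, hρ.fderiv]
  simp only [Function.comp_apply, neg_smul, neg_add_rev, _root_.add_apply, _root_.neg_apply,
    ContinuousLinearMap.smulRight_apply, _root_.smul_apply, smul_eq_mul, neg_neg, hα',
    sub_neg_eq_add, mul_neg, neg_mul]
  field_simp
  ring

variable [FiniteDimensional ℝ E] {k : ℝ}

/-- The coefficients of the linear total differential equation `df = α`, `∇α = - k f g` for pairs
`(f, α)` of a function and a `1`-form. -/
noncomputable def hessianSystem (g : E → E →L[ℝ] E →L[ℝ] ℝ) (Γ : E → E →L[ℝ] E →L[ℝ] E) (k : ℝ)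
    (y : E) : E →L[ℝ] (ℝ × (E →L[ℝ] ℝ)) →L[ℝ] (ℝ × (E →L[ℝ] ℝ)) :=
  (LinearMap.mk₂ ℝ (fun (u : E) (s : ℝ × (E →L[ℝ] ℝ)) ↦
      ((s.2 u, s.2 ∘L Γ y u - (k * s.1) • g y u) : ℝ × (E →L[ℝ] ℝ)))
    (fun u u' s ↦ by ext <;> simp; ring)
    (fun c u s ↦ by ext <;> simp; ring)
    (fun u s s' ↦ by ext <;> simp; ring)
    (fun c u s ↦ by ext <;> simp; ring)).toContinuousBilinearMap

lemma hessianSystem_apply (g : E → E →L[ℝ] E →L[ℝ] ℝ) (Γ : E → E →L[ℝ] E →L[ℝ] E) (k : ℝ)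
    (y u : E) (s : ℝ × (E →L[ℝ] ℝ)) :
    hessianSystem g Γ k y u s = (s.2 u, s.2 ∘L Γ y u - (k * s.1) • g y u) := rfl

lemma contDiffOn_hessianSystem {n : WithTop ℕ∞} (hg : ContDiffOn ℝ n g V)
    (hΓ : ContDiffOn ℝ n Γ V) (k : ℝ) : ContDiffOn ℝ n (hessianSystem g Γ k) V := by
  refine contDiffOn_clm_apply₂.2 fun u s ↦ ?_
  have hαΓ : ContDiffOn ℝ n (fun z ↦ s.2 ∘L Γ z u) V :=
    contDiffOn_const.clm_comp (hΓ.clm_apply contDiffOn_const)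
  exact contDiffOn_const.prodMk (hαΓ.sub ((hg.clm_apply contDiffOn_const).const_smul _))

lemma fderiv_hessianSystem (hg : DifferentiableAt ℝ g y) (hΓ : DifferentiableAt ℝ Γ y)
    (hA : DifferentiableAt ℝ (hessianSystem g Γ k) y) (u v : E) (s : ℝ × (E →L[ℝ] ℝ)) :
    fderiv ℝ (hessianSystem g Γ k) y u v s =
      (0, s.2 ∘L fderiv ℝ Γ y u v - (k * s.1) • fderiv ℝ g y u v) := by
  have hgv := (hg.hasFDerivAt.clm_apply (hasFDerivAt_const v y)).const_smul (k * s.1)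
  have hΓv := (ContinuousLinearMap.compL ℝ E E ℝ s.2).hasFDerivAt.comp y
    (hΓ.hasFDerivAt.clm_apply (hasFDerivAt_const v y))
  have hA_apply : HasFDerivAt (fun z ↦ hessianSystem g Γ k z v s) _ y :=
    (hasFDerivAt_const (s.2 v) y).prodMk (hΓv.sub hgv)
  rw [← fderiv_clm_apply₂_const hA, hA_apply.fderiv]
  simp

namespace IsStatisticalOn

lemma isIntegrableSystemAt_hessianSystem (h : IsStatisticalOn g Γ V) (hy : y ∈ V)
    (hcurv : HasSectionalCurvatureAt g Γ k y) :
    IsIntegrableSystemAt (hessianSystem g Γ k) y := by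
  intro u v s
  have hA : DifferentiableAt ℝ (hessianSystem g Γ k) y :=
    ((contDiffOn_hessianSystem h.contDiffOn_metric h.contDiffOn k).contDiffAt
      (h.isOpen.mem_nhds hy)).differentiableAt (by simp)
  rw [fderiv_hessianSystem (h.differentiableAt_metric hy) (h.differentiableAt hy) hA,
    fderiv_hessianSystem (h.differentiableAt_metric hy) (h.differentiableAt hy) hA]
  refine Prod.ext ?_ (ContinuousLinearMap.ext fun z ↦ ?_)
  · simp [hessianSystem_apply, h.metric_symm y hy u v, h.symm y hy u v]
  · have hcodazzi := h.codazzi y hy u v z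
    have hαcurv := congrArg s.2 (hcurv u v z)
    simp only [christoffelCurvature, map_add, map_sub, map_smul, smul_eq_mul] at hαcurv
    rw [h.symm y hy (Γ y z v) u, h.symm y hy (Γ y z u) v, h.symm y hy z u, h.symm y hy z v,
      h.fderiv_symm hy u z, h.fderiv_symm hy v z] at hαcurv
    rw [h.symm y hy z u, h.symm y hy z v] at hcodazzi
    simp only [hessianSystem_apply, Prod.snd_add, _root_.add_apply, _root_.sub_apply,
      _root_.smul_apply, ContinuousLinearMap.comp_apply, smul_eq_mul]
    linear_combination hαcurv + k * s.1 * hcodazzi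

theorem isProjectivelyFlatAt (h : IsStatisticalOn g Γ V) (hq : q ∈ V)
    (hcurv : ∀ᶠ y in 𝓝 q, HasSectionalCurvatureAt g Γ k y) : IsProjectivelyFlatAt Γ q := by
  have hV := h.isOpen.eventually_mem hq
  have hA := contDiffOn_hessianSystem h.contDiffOn_metric h.contDiffOn k
  obtain ⟨s, hsq, hs⟩ := exists_hasFDerivAt_of_isIntegrableSystemAt
    ((hA.contDiffAt (h.isOpen.mem_nhds hq)).of_le (by norm_cast))
    ((hV.and hcurv).mono fun y hy ↦ h.isIntegrableSystemAt_hessianSystem hy.1 hy.2)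
    ((1, 0) : ℝ × (E →L[ℝ] ℝ))
  obtain ⟨W, hWs, hW, hqW⟩ := eventually_nhds_iff.1 (hV.and hs)
  have hs_smooth : ContDiffOn ℝ ∞ s W :=
    contDiffOn_of_hasFDerivAt (hA.mono fun y hy ↦ (hWs y hy).1) fun y hy ↦ (hWs y hy).2
  have hf_ne : ∀ᶠ y in 𝓝 q, (s y).1 ≠ 0 :=
    (hs_smooth.continuousOn.continuousAt (hW.mem_nhds hqW)).fst.eventually_ne (by simp [hsq])
  refine ⟨fun y ↦ -((s y).1⁻¹ • (s y).2), ?_⟩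
  filter_upwards [hf_ne, hW.eventually_mem hqW, hcurv] with y hfy hyW hcurvy
  obtain ⟨hyV, hsy⟩ := hWs y hyW
  have hs_smoothAt := hs_smooth.contDiffAt (hW.mem_nhds hyW)
  have hρ : ContDiffAt ℝ ∞ (fun y ↦ -((s y).1⁻¹ • (s y).2)) y :=
    ((hs_smoothAt.fst.inv hfy).smul hs_smoothAt.snd).neg
  refine ⟨hρ, (christoffelCurvature_projectiveChange_eq_zero_iff (h.differentiableAt hyV)
    (hρ.differentiableAt (by simp)) (h.symm y hyV) (h.metric_symm y hyV) ?_).2 hcurvy⟩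
  refine schoutenForm_neg_inv_smul (α := fun y ↦ (s y).2) (f := fun y ↦ (s y).1) hsy.fst hsy.snd
    (fun u w ↦ ?_) hfy
  simp [hessianSystem_apply, h.symm y hyV w u]

end IsStatisticalOn

theorem IsConjugatePairOn.isProjectivelyFlatAt_dual (h : IsConjugatePairOn g Γ Γ' V) (hq : q ∈ V)
    (hflat : IsProjectivelyFlatAt Γ q) : IsProjectivelyFlatAt Γ' q := by
  rcases le_or_gt (Module.finrank ℝ E) 1 with hE | hE
  · exact ⟨0, .of_forall fun y ↦ ⟨contDiffAt_const,
      christoffelCurvature_eq_zero_of_finrank_le_one hE _ y⟩⟩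
  obtain ⟨ρ, hρ⟩ := hflat
  have hV := h.isOpen.eventually_mem hq
  have hS : ∀ᶠ y in 𝓝 q, ∃ k, ∀ u v, schoutenForm Γ ρ y u v = k * g y u v :=
    (hV.and hρ).mono fun y ⟨hyV, hρy, hflat⟩ ↦
      h.exists_schoutenForm_eq hyV (hρy.differentiableAt (by simp)) hflat
  obtain ⟨k, hk⟩ := h.isStatisticalOn.exists_eventually_hasSectionalCurvatureAt hE hq
    (hρ.mono fun y hy ↦ hy.1.of_le (by norm_cast)) hS (hρ.mono fun y hy ↦ hy.2)
  refine h.swap.isStatisticalOn.isProjectivelyFlatAt hq (k := k)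
    ((hV.and hk).mono fun y ⟨hyV, hky⟩ u v w ↦ ?_)
  rw [← h.curvature_eq y hyV, hky]

theorem IsConjugatePairOn.isProjectivelyFlatAt_iff (h : IsConjugatePairOn g Γ Γ' V) (hq : q ∈ V) :
    IsProjectivelyFlatAt Γ q ↔ IsProjectivelyFlatAt Γ' q :=
  ⟨h.isProjectivelyFlatAt_dual hq, h.swap.isProjectivelyFlatAt_dual hq⟩

end HessianSystem

end StatisticalStructure

section Chart

set_option maxSynthPendingDepth 3

variable {E : Type*} [NormedAddCommGroup E] [NormedSpace ℝ E]
  {F : Type*} [NormedAddCommGroup F] [NormedSpace ℝ F]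
  {M : Type*} [TopologicalSpace M] [ChartedSpace E M] {p x : M} {y : E}

lemma extChartAt_left_inv (hx : x ∈ (chartAt E p).source) :
    (extChartAt 𝓘(ℝ, E) p).symm (extChartAt 𝓘(ℝ, E) p x) = x :=
  (extChartAt 𝓘(ℝ, E) p).left_inv (by simpa using hx)

lemma extChartAt_mem_target (hx : x ∈ (chartAt E p).source) :
    extChartAt 𝓘(ℝ, E) p x ∈ (extChartAt 𝓘(ℝ, E) p).target :=
  (extChartAt 𝓘(ℝ, E) p).map_source (by simpa using hx)

lemma extChartAt_symm_mem_source (hy : y ∈ (extChartAt 𝓘(ℝ, E) p).target) :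
    (extChartAt 𝓘(ℝ, E) p).symm y ∈ (chartAt E p).source := by
  simpa using (extChartAt 𝓘(ℝ, E) p).map_target hy

lemma exists_extChartAt_eq (hy : y ∈ (extChartAt 𝓘(ℝ, E) p).target) :
    ∃ x ∈ (chartAt E p).source, extChartAt 𝓘(ℝ, E) p x = y :=
  ⟨_, extChartAt_symm_mem_source hy, (extChartAt 𝓘(ℝ, E) p).right_inv hy⟩

lemma eventually_mem_target (hx : x ∈ (chartAt E p).source) :
    ∀ᶠ y in 𝓝 (extChartAt 𝓘(ℝ, E) p x), y ∈ (extChartAt 𝓘(ℝ, E) p).target :=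
  extChartAt_target_mem_nhds' (extChartAt_mem_target hx)

lemma tendsto_extChartAt_symm (hx : x ∈ (chartAt E p).source) :
    Filter.Tendsto (extChartAt 𝓘(ℝ, E) p).symm (𝓝 (extChartAt 𝓘(ℝ, E) p x)) (𝓝 x) := by
  have h := continuousAt_extChartAt_symm'' (extChartAt_mem_target hx)
  rwa [ContinuousAt, extChartAt_left_inv hx] at h

section IsManifold

variable [IsManifold 𝓘(ℝ, E) 1 M]

/-- Reading a tangent vector in the chart at `p`. -/
noncomputable def toCoord (p x : M) : TangentSpace 𝓘(ℝ, E) x →L[ℝ] E :=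
  (trivializationAt E (TangentSpace 𝓘(ℝ, E)) p).continuousLinearMapAt ℝ x

/-- The tangent vector with given coordinates in the chart at `p`. -/
noncomputable def ofCoord (p x : M) : E →L[ℝ] TangentSpace 𝓘(ℝ, E) x :=
  (trivializationAt E (TangentSpace 𝓘(ℝ, E)) p).symmL ℝ x

/-- The representation of a vector field in the chart at `p`. -/
noncomputable def coordRep (p : M) (Y : Π x : M, TangentSpace 𝓘(ℝ, E) x) (y : E) : E :=
  toCoord p ((extChartAt 𝓘(ℝ, E) p).symm y) (Y ((extChartAt 𝓘(ℝ, E) p).symm y))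

/-- The vector field with a given representation in the chart at `p`. -/
noncomputable def coordField (p : M) (V : E → E) (x : M) : TangentSpace 𝓘(ℝ, E) x :=
  ofCoord p x (V (extChartAt 𝓘(ℝ, E) p x))

/-- The representation of a 1-form in the chart at `p`. -/
noncomputable def oneFormRep (p : M) (ρ : Π x : M, TangentSpace 𝓘(ℝ, E) x →L[ℝ] ℝ) (y : E) :
    E →L[ℝ] ℝ :=
  (ρ ((extChartAt 𝓘(ℝ, E) p).symm y)).comp (ofCoord p ((extChartAt 𝓘(ℝ, E) p).symm y))

/-- The 1-form with a given representation in the chart at `p`. -/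
noncomputable def oneFormField (p : M) (ρ : E → E →L[ℝ] ℝ) (x : M) :
    TangentSpace 𝓘(ℝ, E) x →L[ℝ] ℝ :=
  (ρ (extChartAt 𝓘(ℝ, E) p x)).comp (toCoord p x)

lemma toCoord_ofCoord (hx : x ∈ (chartAt E p).source) (w : E) :
    toCoord p x (ofCoord p x w) = w :=
  (trivializationAt E (TangentSpace 𝓘(ℝ, E)) p).continuousLinearMapAt_symmL
    (by simpa using hx) w

lemma ofCoord_toCoord (hx : x ∈ (chartAt E p).source) (v : TangentSpace 𝓘(ℝ, E) x) :
    ofCoord p x (toCoord p x v) = v :=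
  (trivializationAt E (TangentSpace 𝓘(ℝ, E)) p).symmL_continuousLinearMapAt
    (by simpa using hx) v

lemma toCoord_injective (hx : x ∈ (chartAt E p).source) :
    Function.Injective (toCoord (E := E) p x) :=
  Function.LeftInverse.injective (g := ofCoord p x) (ofCoord_toCoord hx)

lemma toCoord_eq_mfderiv (hx : x ∈ (chartAt E p).source) :
    toCoord p x = mfderiv 𝓘(ℝ, E) 𝓘(ℝ, E) (extChartAt 𝓘(ℝ, E) p) x :=
  TangentBundle.continuousLinearMapAt_trivializationAt hx

lemma toCoord_coordField_const (hx : x ∈ (chartAt E p).source) (w : E) :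
    toCoord p x (coordField p (fun _ ↦ w) x) = w :=
  toCoord_ofCoord hx w

lemma coordRep_extChartAt (hx : x ∈ (chartAt E p).source)
    (Y : Π x : M, TangentSpace 𝓘(ℝ, E) x) :
    coordRep p Y (extChartAt 𝓘(ℝ, E) p x) = toCoord p x (Y x) := by
  rw [coordRep, extChartAt_left_inv hx]

lemma coordRep_coordField (hy : y ∈ (extChartAt 𝓘(ℝ, E) p).target) (V : E → E) :
    coordRep p (coordField p V) y = V y := by
  rw [coordRep, coordField, toCoord_ofCoord (extChartAt_symm_mem_source hy),
    (extChartAt 𝓘(ℝ, E) p).right_inv hy]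

lemma coordRep_coordField_eventuallyEq (hx : x ∈ (chartAt E p).source) (V : E → E) :
    coordRep p (coordField p V) =ᶠ[𝓝 (extChartAt 𝓘(ℝ, E) p x)] V :=
  (eventually_mem_target hx).mono fun _ hy ↦ coordRep_coordField hy V

lemma fderiv_coordRep_coordField_const (hx : x ∈ (chartAt E p).source) (w : E) :
    fderiv ℝ (coordRep p (coordField p fun _ ↦ w)) (extChartAt 𝓘(ℝ, E) p x) = 0 :=
  (coordRep_coordField_eventuallyEq hx _).fderiv_eq.trans (fderiv_const_apply w)

lemma oneFormRep_oneFormField (hy : y ∈ (extChartAt 𝓘(ℝ, E) p).target) (ρ : E → E →L[ℝ] ℝ) :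
    oneFormRep p (oneFormField p ρ) y = ρ y := by
  ext w
  rw [oneFormRep, oneFormField, (extChartAt 𝓘(ℝ, E) p).right_inv hy]
  exact congrArg (ρ y) (toCoord_ofCoord (extChartAt_symm_mem_source hy) w)

lemma mdifferentiableAt_iff_differentiableAt_comp_symm {h : M → F}
    (hx : x ∈ (chartAt E p).source) :
    MDifferentiableAt 𝓘(ℝ, E) 𝓘(ℝ, F) h x ↔
      DifferentiableAt ℝ (h ∘ (extChartAt 𝓘(ℝ, E) p).symm) (extChartAt 𝓘(ℝ, E) p x) := by
  rw [mdifferentiableAt_iff_source_of_mem_source hx,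
    mdifferentiableWithinAt_iff_differentiableWithinAt]
  simp [differentiableWithinAt_univ]

lemma mvfderiv_eq_fderiv {h : M → F} (hx : x ∈ (chartAt E p).source)
    (hh : MDifferentiableAt 𝓘(ℝ, E) 𝓘(ℝ, F) h x) (v : TangentSpace 𝓘(ℝ, E) x) :
    mvfderiv 𝓘(ℝ, E) h x v = fderiv ℝ (h ∘ (extChartAt 𝓘(ℝ, E) p).symm)
      (extChartAt 𝓘(ℝ, E) p x) (toCoord p x v) := by
  have hrep := (mdifferentiableAt_iff_differentiableAt_comp_symm hx).1 hh
  have hfactor : h =ᶠ[𝓝 x] (h ∘ (extChartAt 𝓘(ℝ, E) p).symm) ∘ extChartAt 𝓘(ℝ, E) p := by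
    filter_upwards [(chartAt E p).open_source.mem_nhds hx] with z hz
    rw [Function.comp_apply, Function.comp_apply, extChartAt_left_inv hz]
  have hchain : mfderiv 𝓘(ℝ, E) 𝓘(ℝ, F) h x = _ := hfactor.mfderiv_eq
  rw [mfderiv_comp x hrep.mdifferentiableAt (mdifferentiableAt_extChartAt hx), mfderiv_eq_fderiv,
    ← toCoord_eq_mfderiv hx] at hchain
  rw [mvfderiv, hchain]
  rfl

lemma trivializationAt_snd_eventuallyEq (hx : x ∈ (chartAt E p).source)
    (Y : Π x : M, TangentSpace 𝓘(ℝ, E) x) :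
    (fun z ↦ (trivializationAt E (TangentSpace 𝓘(ℝ, E)) p (TotalSpace.mk' E z (Y z))).2)
      =ᶠ[𝓝 x] fun z ↦ toCoord p z (Y z) := by
  filter_upwards [(chartAt E p).open_source.mem_nhds hx] with z hz
  rw [toCoord, Trivialization.continuousLinearMapAt_apply,
    Trivialization.coe_linearMapAt_of_mem _ (by simpa using hz)]

lemma eventuallyEq_mpullback_coordRep (hx : x ∈ (chartAt E p).source)
    {Z : Π x : M, TangentSpace 𝓘(ℝ, E) x} {V : Π y : E, TangentSpace 𝓘(ℝ, E) y}
    (hV : V = coordRep p Z) :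
    Z =ᶠ[𝓝 x] mpullback 𝓘(ℝ, E) 𝓘(ℝ, E) (extChartAt 𝓘(ℝ, E) p) V := by
  filter_upwards [(chartAt E p).open_source.mem_nhds hx] with z hz
  have hinv : (mfderiv 𝓘(ℝ, E) 𝓘(ℝ, E) (extChartAt 𝓘(ℝ, E) p) z).IsInvertible :=
    isInvertible_mfderiv_extChartAt (by simpa using hz)
  have h : mpullback 𝓘(ℝ, E) 𝓘(ℝ, E) (extChartAt 𝓘(ℝ, E) p) V z = Z z := by
    rw [mpullback_apply, hinv.inverse_apply_eq, hV, ← toCoord_eq_mfderiv hz]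
    exact coordRep_extChartAt hz Z
  exact h.symm

end IsManifold

lemma mlieBracket_eq_fderiv (V W : Π y : E, TangentSpace 𝓘(ℝ, E) y) (y : E) :
    mlieBracket 𝓘(ℝ, E) V W y =
      fderiv ℝ (fun y ↦ (W y : E)) y (V y) - fderiv ℝ (fun y ↦ (V y : E)) y (W y) := by
  rw [← mlieBracketWithin_univ, mlieBracketWithin_eq_lieBracketWithin]
  exact congrFun (lieBracketWithin_univ (𝕜 := ℝ) (E := E) (V := V) (W := W)) y

variable [IsManifold 𝓘(ℝ, E) ∞ M]

lemma contMDiffAt_iff_contDiffAt_comp_symm {h : M → F} (hx : x ∈ (chartAt E p).source) :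
    ContMDiffAt 𝓘(ℝ, E) 𝓘(ℝ, F) ∞ h x ↔
      ContDiffAt ℝ ∞ (h ∘ (extChartAt 𝓘(ℝ, E) p).symm) (extChartAt 𝓘(ℝ, E) p x) := by
  rw [contMDiffAt_iff_source_of_mem_source hx, contMDiffWithinAt_iff_contDiffWithinAt]
  simp [contDiffWithinAt_univ]

lemma mdifferentiableAt_section_iff_coordRep {Y : Π x : M, TangentSpace 𝓘(ℝ, E) x}
    (hx : x ∈ (chartAt E p).source) :
    MDiffAt (T% Y) x ↔ DifferentiableAt ℝ (coordRep p Y) (extChartAt 𝓘(ℝ, E) p x) := by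
  rw [(trivializationAt E (TangentSpace 𝓘(ℝ, E)) p).mdifferentiableAt_section_iff _ _
    (by simpa using hx), (trivializationAt_snd_eventuallyEq hx Y).mdifferentiableAt_iff]
  exact mdifferentiableAt_iff_differentiableAt_comp_symm hx

lemma contMDiffAt_section_iff_coordRep {Y : Π x : M, TangentSpace 𝓘(ℝ, E) x}
    (hx : x ∈ (chartAt E p).source) :
    CMDiffAt ∞ (T% Y) x ↔ ContDiffAt ℝ ∞ (coordRep p Y) (extChartAt 𝓘(ℝ, E) p x) := by
  rw [(trivializationAt E (TangentSpace 𝓘(ℝ, E)) p).contMDiffAt_section_iff (by simpa using hx),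
    (trivializationAt_snd_eventuallyEq hx Y).contMDiffAt_iff]
  exact contMDiffAt_iff_contDiffAt_comp_symm hx

lemma contMDiffAt_oneForm_iff_oneFormRep {ρ : Π x : M, TangentSpace 𝓘(ℝ, E) x →L[ℝ] ℝ}
    (hx : x ∈ (chartAt E p).source) :
    ContMDiffAt 𝓘(ℝ, E) (𝓘(ℝ, E).prod 𝓘(ℝ, E →L[ℝ] ℝ)) ∞
      (fun x ↦ (TotalSpace.mk' (E →L[ℝ] ℝ) x (ρ x) : TotalSpace (E →L[ℝ] ℝ)
        (fun x : M ↦ TangentSpace 𝓘(ℝ, E) x →L[ℝ] ℝ))) x ↔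
    ContDiffAt ℝ ∞ (oneFormRep p ρ) (extChartAt 𝓘(ℝ, E) p x) := by
  rw [(trivializationAt (E →L[ℝ] ℝ) (fun x : M ↦ TangentSpace 𝓘(ℝ, E) x →L[ℝ] ℝ)
    p).contMDiffAt_section_iff (by simpa using hx)]
  have hrep : (fun z ↦ (trivializationAt (E →L[ℝ] ℝ)
      (fun x : M ↦ TangentSpace 𝓘(ℝ, E) x →L[ℝ] ℝ) p (TotalSpace.mk' (E →L[ℝ] ℝ) z (ρ z))).2) =
      fun z ↦ (ρ z).comp (ofCoord p z) := by
    ext z v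
    simp [hom_trivializationAt_apply, ContinuousLinearMap.inCoordinates, ofCoord]
  rw [hrep]
  exact contMDiffAt_iff_contDiffAt_comp_symm hx

lemma contMDiffAt_endomorphism_iff
    {A : Π x : M, TangentSpace 𝓘(ℝ, E) x →L[ℝ] TangentSpace 𝓘(ℝ, E) x}
    (hx : x ∈ (chartAt E p).source) :
    ContMDiffAt 𝓘(ℝ, E) (𝓘(ℝ, E).prod 𝓘(ℝ, E →L[ℝ] E)) ∞
      (fun x ↦ (TotalSpace.mk' (E →L[ℝ] E) x (A x) : TotalSpace (E →L[ℝ] E)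
        (fun x : M ↦ TangentSpace 𝓘(ℝ, E) x →L[ℝ] TangentSpace 𝓘(ℝ, E) x))) x ↔
    ContDiffAt ℝ ∞ (fun y ↦ (toCoord p ((extChartAt 𝓘(ℝ, E) p).symm y)).comp
      ((A ((extChartAt 𝓘(ℝ, E) p).symm y)).comp (ofCoord p ((extChartAt 𝓘(ℝ, E) p).symm y))))
      (extChartAt 𝓘(ℝ, E) p x) := by
  rw [(trivializationAt (E →L[ℝ] E)
    (fun x : M ↦ TangentSpace 𝓘(ℝ, E) x →L[ℝ] TangentSpace 𝓘(ℝ, E) x)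
    p).contMDiffAt_section_iff (by simpa using hx)]
  exact contMDiffAt_iff_contDiffAt_comp_symm hx

lemma contMDiffAt_coordField {V : E → E} (hx : x ∈ (chartAt E p).source)
    (hV : ContDiffAt ℝ ∞ V (extChartAt 𝓘(ℝ, E) p x)) : CMDiffAt ∞ (T% (coordField p V)) x :=
  (contMDiffAt_section_iff_coordRep hx).2
    (hV.congr_of_eventuallyEq (coordRep_coordField_eventuallyEq hx V))

lemma contMDiffAt_coordField_const (hx : x ∈ (chartAt E p).source) (w : E) :
    CMDiffAt ∞ (T% (coordField (M := M) p fun _ ↦ w)) x :=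
  contMDiffAt_coordField hx contDiffAt_const

lemma mdifferentiableAt_of_eq_coordRep {Z : Π x : M, TangentSpace 𝓘(ℝ, E) x}
    {V : Π y : E, TangentSpace 𝓘(ℝ, E) y} (hV : V = coordRep p Z)
    (hx : x ∈ (chartAt E p).source) (hZ : CMDiffAt ∞ (T% Z) x) :
    MDiffAt (T% V) (extChartAt 𝓘(ℝ, E) p x) := by
  subst hV
  exact (contMDiffAt_vectorSpace_iff_contDiffAt.2
    ((contMDiffAt_section_iff_coordRep hx).1 hZ)).mdifferentiableAt (by simp)

lemma toCoord_mlieBracket [CompleteSpace E] {X Y : Π x : M, TangentSpace 𝓘(ℝ, E) x}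
    (hx : x ∈ (chartAt E p).source) (hX : CMDiffAt ∞ (T% X) x) (hY : CMDiffAt ∞ (T% Y) x) :
    toCoord p x (mlieBracket 𝓘(ℝ, E) X Y x) =
      fderiv ℝ (coordRep p Y) (extChartAt 𝓘(ℝ, E) p x) (toCoord p x (X x)) -
      fderiv ℝ (coordRep p X) (extChartAt 𝓘(ℝ, E) p x) (toCoord p x (Y x)) := by
  have : IsManifold 𝓘(ℝ, E) (minSmoothness ℝ 2) M := by
    simpa using IsManifold.of_le (I := 𝓘(ℝ, E)) (M := M) (m := 2) (n := ∞) ENat.LEInfty.out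
  -- `mlieBracket` on `E` needs the representations typed as sections of its tangent bundle.
  obtain ⟨V, hV⟩ : ∃ V : Π y : E, TangentSpace 𝓘(ℝ, E) y, V = coordRep p X := ⟨_, rfl⟩
  obtain ⟨W, hW⟩ : ∃ W : Π y : E, TangentSpace 𝓘(ℝ, E) y, W = coordRep p Y := ⟨_, rfl⟩
  have hφ : ContMDiffAt 𝓘(ℝ, E) 𝓘(ℝ, E) ∞ (extChartAt 𝓘(ℝ, E) p) x := contMDiffAt_extChartAt' hx
  have hinv : (mfderiv 𝓘(ℝ, E) 𝓘(ℝ, E) (extChartAt 𝓘(ℝ, E) p) x).IsInvertible :=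
    isInvertible_mfderiv_extChartAt (by simpa using hx)
  have hpull := mpullback_mlieBracket (mdifferentiableAt_of_eq_coordRep hV hx hX)
    (mdifferentiableAt_of_eq_coordRep hW hx hY) hφ (by simpa using ENat.LEInfty.out)
  rw [mpullback_apply, hinv.inverse_apply_eq, ← toCoord_eq_mfderiv hx, mlieBracket_eq_fderiv]
    at hpull
  rw [(eventuallyEq_mpullback_coordRep hx hV).mlieBracket_vectorField_eq
    (eventuallyEq_mpullback_coordRep hx hW)]
  refine hpull.symm.trans ?_
  subst hV hW
  rw [← coordRep_extChartAt hx X, ← coordRep_extChartAt hx Y]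

end Chart

section Christoffel

set_option maxSynthPendingDepth 3

variable {E : Type*} [NormedAddCommGroup E] [NormedSpace ℝ E]

/-- In coordinates, `∇_X Y` is represented by `y ↦ fderiv ℝ Y y (X y) + Γ y (Y y) (X y)`. -/
lemma christoffelCurvature_apply_fields {Γ : E → E →L[ℝ] E →L[ℝ] E} {X Y Z : E → E} {y : E}
    (hX : DifferentiableAt ℝ X y) (hY : DifferentiableAt ℝ Y y) (hZ : ContDiffAt ℝ 2 Z y)
    (hΓ : DifferentiableAt ℝ Γ y) :
    (fderiv ℝ (fun y ↦ fderiv ℝ Z y (Y y) + Γ y (Z y) (Y y)) y (X y)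
        + Γ y (fderiv ℝ Z y (Y y) + Γ y (Z y) (Y y)) (X y))
      - (fderiv ℝ (fun y ↦ fderiv ℝ Z y (X y) + Γ y (Z y) (X y)) y (Y y)
        + Γ y (fderiv ℝ Z y (X y) + Γ y (Z y) (X y)) (Y y))
      - (fderiv ℝ Z y (fderiv ℝ Y y (X y) - fderiv ℝ X y (Y y))
        + Γ y (Z y) (fderiv ℝ Y y (X y) - fderiv ℝ X y (Y y)))
      = christoffelCurvature Γ y (X y) (Y y) (Z y) := by
  have hdZ : DifferentiableAt ℝ (fderiv ℝ Z) y :=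
    (hZ.fderiv_right (m := 1) one_add_one_eq_two.le).differentiableAt one_ne_zero
  have hZy : DifferentiableAt ℝ Z y := hZ.differentiableAt two_ne_zero
  have fderiv_cov {Y : E → E} (hY : DifferentiableAt ℝ Y y) (v : E) :
      fderiv ℝ (fun y ↦ fderiv ℝ Z y (Y y) + Γ y (Z y) (Y y)) y v =
        fderiv ℝ (fderiv ℝ Z) y v (Y y) + fderiv ℝ Z y (fderiv ℝ Y y v)
        + (fderiv ℝ Γ y v (Z y) (Y y) + Γ y (fderiv ℝ Z y v) (Y y)
          + Γ y (Z y) (fderiv ℝ Y y v)) := by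
    rw [fderiv_fun_add (hdZ.clm_apply hY) ((hΓ.clm_apply hZy).clm_apply hY), _root_.add_apply,
      fderiv_clm_apply_apply hdZ hY, fderiv_clm_apply₂ hΓ hZy hY]
  have hsymm := hZ.isSymmSndFDerivAt (by simp) (X y) (Y y)
  rw [fderiv_cov hX, fderiv_cov hY, hsymm]
  simp only [christoffelCurvature, map_add, map_sub, _root_.add_apply]
  abel

variable {M : Type*} [TopologicalSpace M] [ChartedSpace E M] [IsManifold 𝓘(ℝ, E) ∞ M] {p x : M}

/-- The connection for which the coordinate fields of the chart at `p` are parallel. -/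
noncomputable def coordConnection (p : M) (Y : Π x : M, TangentSpace 𝓘(ℝ, E) x) (x : M) :
    TangentSpace 𝓘(ℝ, E) x →L[ℝ] TangentSpace 𝓘(ℝ, E) x :=
  (ofCoord p x).comp ((fderiv ℝ (coordRep p Y) (extChartAt 𝓘(ℝ, E) p x)).comp (toCoord p x))

lemma isCovariantDerivativeOn_coordConnection :
    IsCovariantDerivativeOn E (coordConnection (E := E) p) (chartAt E p).source where
  add {σ σ' x} hσ hσ' hx := by
    have hadd : coordRep p (σ + σ') = coordRep p σ + coordRep p σ' :=
      funext fun _ ↦ map_add (toCoord p _) _ _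
    ext v
    simp only [coordConnection, hadd, fderiv_add
      ((mdifferentiableAt_section_iff_coordRep hx).1 hσ)
      ((mdifferentiableAt_section_iff_coordRep hx).1 hσ'), ContinuousLinearMap.comp_apply,
      _root_.add_apply, map_add]
  leibniz {σ g x} hσ hg hx := by
    have hsmul : coordRep p (g • σ) = (g ∘ (extChartAt 𝓘(ℝ, E) p).symm) • coordRep p σ :=
      funext fun _ ↦ map_smul (toCoord p _) _ _
    ext v
    simp only [coordConnection, hsmul, fderiv_smul
      ((mdifferentiableAt_iff_differentiableAt_comp_symm hx).1 hg)
      ((mdifferentiableAt_section_iff_coordRep hx).1 hσ), ContinuousLinearMap.comp_apply,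
      _root_.add_apply, _root_.smul_apply, map_add, map_smul, ContinuousLinearMap.smulRight_apply,
      mvfderiv_eq_fderiv hx hg, coordRep_extChartAt hx, ofCoord_toCoord hx, Function.comp,
      extChartAt_left_inv hx]

variable {cov : CovariantDerivative 𝓘(ℝ, E) E (TangentSpace 𝓘(ℝ, E) : M → Type _)}
  {X Y Z : Π x : M, TangentSpace 𝓘(ℝ, E) x}

lemma eventually_mdifferentiableAt (hx : x ∈ (chartAt E p).source) (hY : CMDiffAt ∞ (T% Y) x) :
    ∀ᶠ y in 𝓝 (extChartAt 𝓘(ℝ, E) p x), MDiffAt (T% Y) ((extChartAt 𝓘(ℝ, E) p).symm y) := by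
  have hrep := (contMDiffAt_section_iff_coordRep hx).1 hY
  filter_upwards [(hrep.of_le (m := 1) (by simp)).eventually (by simp),
    eventually_mem_target hx] with y hy hyt
  rw [mdifferentiableAt_section_iff_coordRep (extChartAt_symm_mem_source hyt),
    (extChartAt 𝓘(ℝ, E) p).right_inv hyt]
  exact hy.differentiableAt one_ne_zero

lemma cov_congr (hY : CMDiffAt ∞ (T% Y) x) (hZ : CMDiffAt ∞ (T% Z) x)
    (h : ∀ᶠ z in 𝓝 x, Y z = Z z) : cov Y x = cov Z x :=
  (cov.isCovariantDerivativeOn (s := univ)).congr_of_eventuallyEq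
    (hY.mdifferentiableAt (by simp)) (hZ.mdifferentiableAt (by simp)) Filter.univ_mem h

lemma exists_contMDiff_eventuallyEq [FiniteDimensional ℝ E] [T2Space M] {U : Set M}
    (hU : IsOpen U) (hx : x ∈ U) (hY : CMDiff[U] ∞ (T% Y)) :
    ∃ Y' : Π x : M, TangentSpace 𝓘(ℝ, E) x, CMDiff ∞ (T% Y') ∧ ∀ᶠ z in 𝓝 x, Y' z = Y z := by
  obtain ⟨f, -, hf⟩ :=
    (SmoothBumpFunction.nhds_basis_tsupport (I := 𝓘(ℝ, E)) x).mem_iff.1 (hU.mem_nhds hx)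
  refine ⟨(f : M → ℝ) • Y,
    ContMDiffOn.smul_section_of_tsupport f.contMDiff.contMDiffOn hU hf hY, ?_⟩
  filter_upwards [f.eventuallyEq_one] with z hz
  simp [hz]

lemma exists_contMDiff_eventuallyEq_coordField_const [FiniteDimensional ℝ E] [T2Space M]
    (hx : x ∈ (chartAt E p).source) (w : E) :
    ∃ Y : Π x : M, TangentSpace 𝓘(ℝ, E) x, CMDiff ∞ (T% Y) ∧
      ∀ᶠ z in 𝓝 x, Y z = coordField p (fun _ ↦ w) z :=
  exists_contMDiff_eventuallyEq (chartAt E p).open_source hx fun _ hz ↦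
    (contMDiffAt_coordField_const hz w).contMDiffWithinAt

lemma exists_contMDiff_toCoord_eq [FiniteDimensional ℝ E] [T2Space M]
    (hx : x ∈ (chartAt E p).source) (w : E) :
    ∃ Y : Π x : M, TangentSpace 𝓘(ℝ, E) x, CMDiff ∞ (T% Y) ∧ toCoord p x (Y x) = w := by
  obtain ⟨Y, hY, hYw⟩ := exists_contMDiff_eventuallyEq_coordField_const hx w
  exact ⟨Y, hY, by rw [hYw.self_of_nhds, toCoord_coordField_const hx]⟩

variable [FiniteDimensional ℝ E]

/-- The Christoffel symbols of `∇` in the chart at `p`, that is, the difference of `∇` and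
`coordConnection p` read in coordinates: `christoffel cov p y w u` represents `∇_{∂u} ∂w`, where
`∂u` is the coordinate field with constant representation `u`. -/
noncomputable def christoffel
    (cov : CovariantDerivative 𝓘(ℝ, E) E (TangentSpace 𝓘(ℝ, E) : M → Type _)) (p : M) (y : E) :
    E →L[ℝ] E →L[ℝ] E :=
  ContinuousLinearMap.postcomp E (toCoord p ((extChartAt 𝓘(ℝ, E) p).symm y)) ∘L
    ContinuousLinearMap.precomp _ (ofCoord p ((extChartAt 𝓘(ℝ, E) p).symm y)) ∘L
      (cov.isCovariantDerivativeOn (s := (chartAt E p).source)).difference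
        isCovariantDerivativeOn_coordConnection ((extChartAt 𝓘(ℝ, E) p).symm y) ∘L
          ofCoord p ((extChartAt 𝓘(ℝ, E) p).symm y)

lemma toCoord_cov (hx : x ∈ (chartAt E p).source) (hY : MDiffAt (T% Y) x)
    (v : TangentSpace 𝓘(ℝ, E) x) :
    toCoord p x (cov Y x v) =
      fderiv ℝ (coordRep p Y) (extChartAt 𝓘(ℝ, E) p x) (toCoord p x v) +
      christoffel cov p (extChartAt 𝓘(ℝ, E) p x) (toCoord p x (Y x)) (toCoord p x v) := by
  have hdiff : christoffel cov p (extChartAt 𝓘(ℝ, E) p x) (toCoord p x (Y x)) (toCoord p x v) =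
      toCoord p x ((cov.isCovariantDerivativeOn (s := (chartAt E p).source)).difference
          isCovariantDerivativeOn_coordConnection x (Y x) v) := by
    simp only [christoffel, ContinuousLinearMap.comp_apply, ContinuousLinearMap.postcomp_apply,
      ContinuousLinearMap.precomp_apply]
    rw [extChartAt_left_inv hx, ofCoord_toCoord hx, ofCoord_toCoord hx]
  rw [hdiff, IsCovariantDerivativeOn.difference_apply _ _ hx hY]
  simp [coordConnection, toCoord_ofCoord hx]

lemma christoffel_apply (hx : x ∈ (chartAt E p).source) (w u : E) :
    christoffel cov p (extChartAt 𝓘(ℝ, E) p x) w u =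
      toCoord p x (cov (coordField p fun _ ↦ w) x (ofCoord p x u)) := by
  rw [toCoord_cov hx ((contMDiffAt_coordField_const hx w).mdifferentiableAt (by simp)),
    fderiv_coordRep_coordField_const hx, toCoord_ofCoord hx, toCoord_coordField_const hx,
    _root_.zero_apply, zero_add]

lemma coordRep_cov (hx : x ∈ (chartAt E p).source) (hZ : CMDiffAt ∞ (T% Z) x) :
    coordRep p (fun z ↦ cov Z z (Y z)) =ᶠ[𝓝 (extChartAt 𝓘(ℝ, E) p x)] fun y ↦
      fderiv ℝ (coordRep p Z) y (coordRep p Y y) +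
        christoffel cov p y (coordRep p Z y) (coordRep p Y y) := by
  filter_upwards [eventually_mdifferentiableAt hx hZ, eventually_mem_target hx] with y hy hyt
  have h := toCoord_cov (cov := cov) (extChartAt_symm_mem_source hyt) hy
    (Y ((extChartAt 𝓘(ℝ, E) p).symm y))
  rw [(extChartAt 𝓘(ℝ, E) p).right_inv hyt] at h
  exact h

lemma contMDiffAt_cov (hx : x ∈ (chartAt E p).source)
    (hΓ : ContDiffAt ℝ ∞ (christoffel cov p) (extChartAt 𝓘(ℝ, E) p x))
    (hY : CMDiffAt ∞ (T% Y) x) :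
    ContMDiffAt 𝓘(ℝ, E) (𝓘(ℝ, E).prod 𝓘(ℝ, E →L[ℝ] E)) ∞
      (fun x ↦ (TotalSpace.mk' (E →L[ℝ] E) x (cov Y x) : TotalSpace (E →L[ℝ] E)
        (fun x : M ↦ TangentSpace 𝓘(ℝ, E) x →L[ℝ] TangentSpace 𝓘(ℝ, E) x))) x := by
  rw [contMDiffAt_endomorphism_iff hx]
  have hrep := (contMDiffAt_section_iff_coordRep hx).1 hY
  refine ((hrep.fderiv_right (m := ∞) le_rfl).add
    (hΓ.clm_apply hrep)).congr_of_eventuallyEq ?_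
  filter_upwards [eventually_mdifferentiableAt hx hY, eventually_mem_target hx] with y hy hyt
  ext v
  have h := toCoord_cov (cov := cov) (extChartAt_symm_mem_source hyt) hy
    (ofCoord p ((extChartAt 𝓘(ℝ, E) p).symm y) v)
  rw [(extChartAt 𝓘(ℝ, E) p).right_inv hyt,
    toCoord_ofCoord (extChartAt_symm_mem_source hyt)] at h
  exact h

lemma contDiffOn_christoffel [T2Space M]
    (hcov : CovariantDerivative.ContMDiffCovariantDerivative cov ∞) :
    ContDiffOn ℝ ∞ (christoffel cov p) (extChartAt 𝓘(ℝ, E) p).target := by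
  refine contDiffOn_clm_apply₂.2 fun w u y hy ↦ ?_
  obtain ⟨x, hx, rfl⟩ := exists_extChartAt_eq hy
  obtain ⟨Y, hY, hYw⟩ := exists_contMDiff_eventuallyEq_coordField_const hx w
  have hcovY := (hcov.contMDiff.contMDiff (σ := Y) hY.contMDiffOn).contMDiffAt
    (Filter.univ_mem (f := 𝓝 x))
  have hcovYu := hcovY.clm_bundle_apply (contMDiffAt_coordField_const hx u)
  refine ((contMDiffAt_section_iff_coordRep hx).1 hcovYu).congr_of_eventuallyEq ?_
    |>.contDiffWithinAt
  filter_upwards [eventually_mem_target hx,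
    (tendsto_extChartAt_symm hx).eventually hYw.eventually_nhds] with y hy hYwy
  have hz := extChartAt_symm_mem_source hy
  have h := christoffel_apply (cov := cov) hz w u
  rw [(extChartAt 𝓘(ℝ, E) p).right_inv hy] at h
  rw [h, ← cov_congr hY.contMDiffAt (contMDiffAt_coordField_const hz w) hYwy]
  rfl

lemma toCoord_cov_cov (hx : x ∈ (chartAt E p).source)
    (hΓ : ContDiffAt ℝ ∞ (christoffel cov p) (extChartAt 𝓘(ℝ, E) p x))
    (hY : CMDiffAt ∞ (T% Y) x) (hZ : CMDiffAt ∞ (T% Z) x) (v : TangentSpace 𝓘(ℝ, E) x) :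
    toCoord p x (cov (fun y ↦ cov Z y (Y y)) x v) =
      fderiv ℝ (fun y ↦ fderiv ℝ (coordRep p Z) y (coordRep p Y y) +
        christoffel cov p y (coordRep p Z y) (coordRep p Y y)) (extChartAt 𝓘(ℝ, E) p x)
        (toCoord p x v) +
      christoffel cov p (extChartAt 𝓘(ℝ, E) p x)
        (fderiv ℝ (coordRep p Z) (extChartAt 𝓘(ℝ, E) p x) (toCoord p x (Y x)) +
          christoffel cov p (extChartAt 𝓘(ℝ, E) p x) (toCoord p x (Z x)) (toCoord p x (Y x)))
        (toCoord p x v) := by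
  have hcov : CMDiffAt ∞ (T% (fun y ↦ cov Z y (Y y))) x :=
    (contMDiffAt_cov hx hΓ hZ).clm_bundle_apply hY
  rw [toCoord_cov hx (hcov.mdifferentiableAt (by simp)), (coordRep_cov hx hZ).fderiv_eq,
    toCoord_cov hx (hZ.mdifferentiableAt (by simp))]

lemma toCoord_curvature (hx : x ∈ (chartAt E p).source)
    (hΓ : ContDiffAt ℝ ∞ (christoffel cov p) (extChartAt 𝓘(ℝ, E) p x))
    (hX : CMDiffAt ∞ (T% X) x) (hY : CMDiffAt ∞ (T% Y) x) (hZ : CMDiffAt ∞ (T% Z) x) :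
    toCoord p x (curvature cov.toFun X Y Z x) =
      christoffelCurvature (christoffel cov p) (extChartAt 𝓘(ℝ, E) p x)
        (toCoord p x (X x)) (toCoord p x (Y x)) (toCoord p x (Z x)) := by
  have := FiniteDimensional.complete ℝ E
  have hrep {V : Π x : M, TangentSpace 𝓘(ℝ, E) x} (hV : CMDiffAt ∞ (T% V) x) :
      ContDiffAt ℝ 2 (coordRep p V) (extChartAt 𝓘(ℝ, E) p x) :=
    ((contMDiffAt_section_iff_coordRep hx).1 hV).of_le ENat.LEInfty.out
  rw [curvature, map_sub, map_sub, toCoord_cov_cov hx hΓ hY hZ, toCoord_cov_cov hx hΓ hX hZ,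
    toCoord_cov hx (hZ.mdifferentiableAt (by simp)), toCoord_mlieBracket hx hX hY]
  simp only [← coordRep_extChartAt hx]
  exact christoffelCurvature_apply_fields ((hrep hX).differentiableAt two_ne_zero)
    ((hrep hY).differentiableAt two_ne_zero) (hrep hZ) (hΓ.differentiableAt (by simp))

lemma christoffel_symm {y : E} (htors : cov.torsion = 0)
    (hy : y ∈ (extChartAt 𝓘(ℝ, E) p).target) (a b : E) :
    christoffel cov p y a b = christoffel cov p y b a := by
  have := FiniteDimensional.complete ℝ E
  obtain ⟨x, hx, rfl⟩ := exists_extChartAt_eq hy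
  have hsmooth (w : E) : CMDiffAt ∞ (T% (coordField (M := M) p fun _ ↦ w)) x :=
    contMDiffAt_coordField_const hx w
  have htors_coord := congrArg (toCoord p x) ((CovariantDerivative.torsion_eq_zero_iff cov).1 htors
    ((hsmooth b).mdifferentiableAt (by simp)) ((hsmooth a).mdifferentiableAt (by simp)))
  rw [map_sub, toCoord_mlieBracket hx (hsmooth b) (hsmooth a),
    fderiv_coordRep_coordField_const hx, fderiv_coordRep_coordField_const hx] at htors_coord
  simp only [_root_.zero_apply, sub_zero, sub_eq_zero] at htors_coord
  rw [christoffel_apply hx, christoffel_apply hx]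
  exact htors_coord

end Christoffel

section ProjectiveChange

set_option maxSynthPendingDepth 3

variable {E : Type*} [NormedAddCommGroup E] [NormedSpace ℝ E]
  {M : Type*} [TopologicalSpace M] [ChartedSpace E M] [IsManifold 𝓘(ℝ, E) ∞ M] {p x : M} {y : E}
  {cov : CovariantDerivative 𝓘(ℝ, E) E (TangentSpace 𝓘(ℝ, E) : M → Type _)}

lemma curvature_congr {U : Set M} (hU : IsOpen U) (hx : x ∈ U)
    {D : (Π x : M, TangentSpace 𝓘(ℝ, E) x) →
      (Π x : M, TangentSpace 𝓘(ℝ, E) x →L[ℝ] TangentSpace 𝓘(ℝ, E) x)}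
    (hD : ContMDiffCovariantDerivativeOn E ∞ D U)
    (hDcov : ∀ Y : (Π x : M, TangentSpace 𝓘(ℝ, E) x), CMDiff[U] ∞ (T% Y) → ∀ x ∈ U,
      ∀ v : TangentSpace 𝓘(ℝ, E) x, D Y x v = cov Y x v)
    {X Y Z : Π x : M, TangentSpace 𝓘(ℝ, E) x} (hX : CMDiff[U] ∞ (T% X))
    (hY : CMDiff[U] ∞ (T% Y)) (hZ : CMDiff[U] ∞ (T% Z)) :
    curvature D X Y Z x = curvature cov.toFun X Y Z x := by
  have hsecond {Y : Π x : M, TangentSpace 𝓘(ℝ, E) x} (hY : CMDiff[U] ∞ (T% Y))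
      (v : TangentSpace 𝓘(ℝ, E) x) :
      D (fun y ↦ D Z y (Y y)) x v = cov (fun y ↦ cov Z y (Y y)) x v := by
    have hDZ : CMDiff[U] ∞ (T% (fun y ↦ D Z y (Y y))) :=
      (hD.contMDiff (σ := Z) hZ).clm_bundle_apply hY
    have heq : ∀ᶠ z in 𝓝 x, cov Z z (Y z) = D Z z (Y z) := by
      filter_upwards [hU.mem_nhds hx] with z hz using (hDcov Z hZ z hz _).symm
    have hDZx := hDZ.contMDiffAt (hU.mem_nhds hx)
    have hcovZx : CMDiffAt ∞ (T% (fun y ↦ cov Z y (Y y))) x := by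
      refine hDZx.congr_of_eventuallyEq ?_
      filter_upwards [heq] with z hz
      rw [hz]
    rw [hDcov _ hDZ x hx, cov_congr hcovZx hDZx heq]
  rw [curvature, curvature, hsecond hX, hsecond hY, hDcov Z hZ x hx]

/-- `symmProd` on a tangent space: the bilinear map `(w, u) ↦ α(w) u + α(u) w`. -/
noncomputable def symmProdTangent (x : M) (α : TangentSpace 𝓘(ℝ, E) x →L[ℝ] ℝ) :
    TangentSpace 𝓘(ℝ, E) x →L[ℝ] TangentSpace 𝓘(ℝ, E) x →L[ℝ] TangentSpace 𝓘(ℝ, E) x :=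
  symmProd (E := E) α

/-- The projective change `∇_X Y + ρ(X) Y + ρ(Y) X` of a connection by a 1-form. -/
noncomputable def projectiveCov
    (cov : CovariantDerivative 𝓘(ℝ, E) E (TangentSpace 𝓘(ℝ, E) : M → Type _))
    (ρ : Π x : M, TangentSpace 𝓘(ℝ, E) x →L[ℝ] ℝ) :
    CovariantDerivative 𝓘(ℝ, E) E (TangentSpace 𝓘(ℝ, E) : M → Type _) :=
  cov.addOneForm fun x ↦ symmProdTangent x (ρ x)

lemma projectiveCov_apply (ρ : Π x : M, TangentSpace 𝓘(ℝ, E) x →L[ℝ] ℝ)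
    (Y : Π x : M, TangentSpace 𝓘(ℝ, E) x) (v : TangentSpace 𝓘(ℝ, E) x) :
    projectiveCov cov ρ Y x v = cov Y x v + ρ x v • Y x + ρ x (Y x) • v := by
  rw [add_assoc, add_comm (ρ x v • Y x)]
  exact congrArg (cov Y x v + ·) (symmProd_apply (E := E) (ρ x) (Y x) v)

variable [FiniteDimensional ℝ E]

lemma torsion_projectiveCov (htors : cov.torsion = 0)
    (ρ : Π x : M, TangentSpace 𝓘(ℝ, E) x →L[ℝ] ℝ) : (projectiveCov cov ρ).torsion = 0 := by
  have := FiniteDimensional.complete ℝ E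
  refine (CovariantDerivative.torsion_eq_zero_iff _).2 fun {X Y x} hX hY ↦ ?_
  rw [← (CovariantDerivative.torsion_eq_zero_iff _).1 htors hX hY, projectiveCov_apply,
    projectiveCov_apply]
  abel

lemma christoffel_projectiveCov (hy : y ∈ (extChartAt 𝓘(ℝ, E) p).target)
    (ρ : Π x : M, TangentSpace 𝓘(ℝ, E) x →L[ℝ] ℝ) :
    christoffel (projectiveCov cov ρ) p y =
      projectiveChange (christoffel cov p) (oneFormRep p ρ) y := by
  obtain ⟨x, hx, rfl⟩ := exists_extChartAt_eq hy
  ext a u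
  rw [christoffel_apply hx, projectiveCov_apply, projectiveChange_apply, christoffel_apply hx,
    oneFormRep, extChartAt_left_inv hx]
  simp only [map_add, map_smul, coordField, toCoord_ofCoord hx, ContinuousLinearMap.comp_apply]
  abel

lemma christoffel_projectiveCov_eventuallyEq (hx : x ∈ (chartAt E p).source)
    (ρ : Π x : M, TangentSpace 𝓘(ℝ, E) x →L[ℝ] ℝ) :
    christoffel (projectiveCov cov ρ) p =ᶠ[𝓝 (extChartAt 𝓘(ℝ, E) p x)]
      projectiveChange (christoffel cov p) (oneFormRep p ρ) :=
  (eventually_mem_target hx).mono fun _ hy ↦ christoffel_projectiveCov hy ρ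

lemma christoffelCurvature_eq_zero_of_isFlatOn [T2Space M] {U : Set M} (hU : IsOpen U)
    {D : (Π x : M, TangentSpace 𝓘(ℝ, E) x) →
      (Π x : M, TangentSpace 𝓘(ℝ, E) x →L[ℝ] TangentSpace 𝓘(ℝ, E) x)}
    (hD : IsFlatOn D U)
    (hDcov : ∀ Y : (Π x : M, TangentSpace 𝓘(ℝ, E) x), CMDiff[U] ∞ (T% Y) → ∀ x ∈ U,
      ∀ v : TangentSpace 𝓘(ℝ, E) x, D Y x v = cov Y x v)
    (hx : x ∈ (chartAt E p).source) (hxU : x ∈ U)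
    (hΓ : ContDiffAt ℝ ∞ (christoffel cov p) (extChartAt 𝓘(ℝ, E) p x)) (u v w : E) :
    christoffelCurvature (christoffel cov p) (extChartAt 𝓘(ℝ, E) p x) u v w = 0 := by
  obtain ⟨X, hX, rfl⟩ := exists_contMDiff_toCoord_eq hx u
  obtain ⟨Y, hY, rfl⟩ := exists_contMDiff_toCoord_eq hx v
  obtain ⟨Z, hZ, rfl⟩ := exists_contMDiff_toCoord_eq hx w
  rw [← toCoord_curvature hx hΓ hX.contMDiffAt hY.contMDiffAt hZ.contMDiffAt,
    ← curvature_congr hU hxU hD.smooth hDcov hX.contMDiffOn hY.contMDiffOn hZ.contMDiffOn,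
    hD.curvature_eq_zero X Y Z hX.contMDiffOn hY.contMDiffOn hZ.contMDiffOn x hxU, map_zero]

lemma isFlatOn_of_christoffelCurvature_eq_zero (htors : cov.torsion = 0) {U : Set M}
    (hU : IsOpen U) (hUp : U ⊆ (chartAt E p).source)
    (hΓ : ∀ x ∈ U, ContDiffAt ℝ ∞ (christoffel cov p) (extChartAt 𝓘(ℝ, E) p x))
    (hR : ∀ x ∈ U, ∀ u v w,
      christoffelCurvature (christoffel cov p) (extChartAt 𝓘(ℝ, E) p x) u v w = 0) :
    IsFlatOn cov.toFun U where
  isCovariantDerivativeOn := cov.isCovariantDerivativeOn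
  smooth := ⟨fun hσ x hx ↦ (contMDiffAt_cov (hUp hx) (hΓ x hx)
    (hσ.contMDiffAt (hU.mem_nhds hx))).contMDiffWithinAt⟩
  torsion_eq_zero X Y hX hY x hx := by
    have := FiniteDimensional.complete ℝ E
    exact sub_eq_zero.2 ((CovariantDerivative.torsion_eq_zero_iff cov).1 htors
      ((hX.contMDiffAt (hU.mem_nhds hx)).mdifferentiableAt (by simp))
      ((hY.contMDiffAt (hU.mem_nhds hx)).mdifferentiableAt (by simp)))
  curvature_eq_zero X Y Z hX hY hZ x hx := by
    refine toCoord_injective (hUp hx) ?_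
    rw [toCoord_curvature (hUp hx) (hΓ x hx) (hX.contMDiffAt (hU.mem_nhds hx))
      (hY.contMDiffAt (hU.mem_nhds hx)) (hZ.contMDiffAt (hU.mem_nhds hx)), hR x hx, map_zero]

lemma isProjectivelyFlatAt_christoffel [T2Space M]
    (hΓ : ContDiffOn ℝ ∞ (christoffel cov p) (extChartAt 𝓘(ℝ, E) p).target) {U : Set M}
    (hU : IsOpen U) (hpU : p ∈ U)
    {D : (Π x : M, TangentSpace 𝓘(ℝ, E) x) →
      (Π x : M, TangentSpace 𝓘(ℝ, E) x →L[ℝ] TangentSpace 𝓘(ℝ, E) x)}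
    (hD : IsFlatOn D U) (hDcov : ProjectivelyEquivalentOn cov.toFun D U) :
    IsProjectivelyFlatAt (christoffel cov p) (extChartAt 𝓘(ℝ, E) p p) := by
  obtain ⟨ρ, hρ, hDρ⟩ := hDcov
  have hp := mem_chart_source E p
  refine ⟨oneFormRep p ρ, ?_⟩
  filter_upwards [eventually_mem_target hp,
    (tendsto_extChartAt_symm hp).eventually (hU.mem_nhds hpU)] with y hy hyU
  obtain ⟨x, hx, rfl⟩ := exists_extChartAt_eq hy
  rw [extChartAt_left_inv hx] at hyU
  have hρx : ContDiffAt ℝ ∞ (oneFormRep p ρ) (extChartAt 𝓘(ℝ, E) p x) :=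
    (contMDiffAt_oneForm_iff_oneFormRep hx).1 (hρ.contMDiffAt (hU.mem_nhds hyU))
  have hchange := christoffel_projectiveCov_eventuallyEq (cov := cov) hx ρ
  have hΓρ := (contDiffAt_projectiveChange (hΓ.contDiffAt (eventually_mem_target hx))
    hρx).congr_of_eventuallyEq hchange
  refine ⟨hρx, fun u v w ↦ ?_⟩
  rw [← christoffelCurvature_congr hchange]
  exact christoffelCurvature_eq_zero_of_isFlatOn hU hD
    (fun Y hY x hx v ↦ (hDρ Y hY x hx v).trans (projectiveCov_apply ρ Y v).symm) hx hyU hΓρ u v w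

lemma exists_isFlatOn_of_isProjectivelyFlatAt (htors : cov.torsion = 0)
    (hΓ : ContDiffOn ℝ ∞ (christoffel cov p) (extChartAt 𝓘(ℝ, E) p).target)
    (h : IsProjectivelyFlatAt (christoffel cov p) (extChartAt 𝓘(ℝ, E) p p)) :
    ∃ U : Set M, IsOpen U ∧ p ∈ U ∧
      ∃ D : (Π x : M, TangentSpace 𝓘(ℝ, E) x) →
        (Π x : M, TangentSpace 𝓘(ℝ, E) x →L[ℝ] TangentSpace 𝓘(ℝ, E) x),
      IsFlatOn D U ∧ ProjectivelyEquivalentOn cov.toFun D U := by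
  obtain ⟨ρ, hρ⟩ := h
  obtain ⟨W, hW, hWo, hpW⟩ := eventually_nhds_iff.1 hρ
  have hU : IsOpen ((chartAt E p).source ∩ extChartAt 𝓘(ℝ, E) p ⁻¹' W) :=
    isOpen_extChartAt_preimage p hWo
  have hrep {x : M} (hx : x ∈ (chartAt E p).source) :
      oneFormRep p (oneFormField p ρ) =ᶠ[𝓝 (extChartAt 𝓘(ℝ, E) p x)] ρ :=
    (eventually_mem_target hx).mono fun _ hy ↦ oneFormRep_oneFormField hy ρ
  have hchange {x : M} (hx : x ∈ (chartAt E p).source) :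
      christoffel (projectiveCov cov (oneFormField p ρ)) p =ᶠ[𝓝 (extChartAt 𝓘(ℝ, E) p x)]
        projectiveChange (christoffel cov p) ρ := by
    filter_upwards [christoffel_projectiveCov_eventuallyEq hx _, hrep hx] with y hy hyρ
    rw [hy, projectiveChange, projectiveChange, hyρ]
  refine ⟨_, hU, ⟨mem_chart_source E p, hpW⟩, (projectiveCov cov (oneFormField p ρ)).toFun,
    isFlatOn_of_christoffelCurvature_eq_zero (torsion_projectiveCov htors _) hU
      inter_subset_left (fun x hx ↦ ?_) (fun x hx u v w ↦ ?_),
    oneFormField p ρ, fun x hx ↦ ?_, fun Y _ x _ v ↦ projectiveCov_apply _ Y v⟩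
  · exact (contDiffAt_projectiveChange (hΓ.contDiffAt (eventually_mem_target hx.1))
      (hW _ hx.2).1).congr_of_eventuallyEq (hchange hx.1)
  · rw [christoffelCurvature_congr (hchange hx.1), (hW _ hx.2).2]
  · exact ((contMDiffAt_oneForm_iff_oneFormRep hx.1).2
      ((hW _ hx.2).1.congr_of_eventuallyEq (hrep hx.1))).contMDiffWithinAt

theorem isProjectivelyFlat_iff [T2Space M] (htors : cov.torsion = 0)
    (hΓ : ∀ p : M, ContDiffOn ℝ ∞ (christoffel cov p) (extChartAt 𝓘(ℝ, E) p).target) :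
    IsProjectivelyFlat cov ↔
      ∀ p : M, IsProjectivelyFlatAt (christoffel cov p) (extChartAt 𝓘(ℝ, E) p p) := by
  refine forall_congr' fun p ↦
    ⟨?_, fun h ↦ exists_isFlatOn_of_isProjectivelyFlatAt htors (hΓ p) h⟩
  rintro ⟨U, hU, hpU, D, hD, hDcov⟩
  exact isProjectivelyFlatAt_christoffel (hΓ p) hU hpU hD hDcov

end ProjectiveChange

section Nondegenerate

variable {E : Type*} [NormedAddCommGroup E] [NormedSpace ℝ E] [FiniteDimensional ℝ E]

lemma isInvertible_of_pos {g : E →L[ℝ] E →L[ℝ] ℝ} (hg : ∀ a, a ≠ 0 → 0 < g a a) :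
    g.IsInvertible := by
  have hinj : Function.Injective (g : E →ₗ[ℝ] E →L[ℝ] ℝ) := by
    refine (injective_iff_map_eq_zero _).2 fun a ha ↦ not_imp_comm.1 (hg a) ?_
    rw [show g a = 0 from ha]
    exact lt_irrefl 0
  have hdim : Module.finrank ℝ E = Module.finrank ℝ (E →L[ℝ] ℝ) := by
    rw [← (LinearMap.toContinuousLinearMap : (E →ₗ[ℝ] ℝ) ≃ₗ[ℝ] (E →L[ℝ] ℝ)).finrank_eq]
    exact (Subspace.dual_finrank_eq (K := ℝ) (V := E)).symm
  exact ⟨(LinearEquiv.ofInjectiveOfFinrankEq _ hinj hdim).toContinuousLinearEquiv, by ext; rfl⟩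

lemma contDiffOn_of_contDiffOn_metric_apply {F : Type*} [NormedAddCommGroup F] [NormedSpace ℝ F]
    {g : F → E →L[ℝ] E →L[ℝ] ℝ} {V : Set F} {n : WithTop ℕ∞}
    (hg : ContDiffOn ℝ n g V) (hpos : ∀ y ∈ V, ∀ a, a ≠ 0 → 0 < g y a a) {X : F → E}
    (hX : ∀ a, ContDiffOn ℝ n (fun y ↦ g y (X y) a) V) : ContDiffOn ℝ n X V := by
  have hgX : ContDiffOn ℝ n (fun y ↦ g y (X y)) V := contDiffOn_clm_apply.2 hX
  have hinv : ContDiffOn ℝ n (fun y ↦ (g y).inverse) V := by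
    intro y hy
    obtain ⟨e, he⟩ := isInvertible_of_pos (hpos y hy)
    exact (he ▸ contDiffAt_map_inverse e).comp_contDiffWithinAt y (hg y hy)
  exact (hinv.clm_apply hgX).congr fun y hy ↦
    ((isInvertible_of_pos (hpos y hy)).inverse_apply_eq.2 rfl).symm

end Nondegenerate

section Dual

set_option maxSynthPendingDepth 3

variable {E : Type*} [NormedAddCommGroup E] [NormedSpace ℝ E]
  {M : Type*} [TopologicalSpace M] [ChartedSpace E M] [IsManifold 𝓘(ℝ, E) ∞ M] {p x : M} {y : E}
  [RiemannianBundle (fun x : M ↦ TangentSpace 𝓘(ℝ, E) x)]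

/-- The coordinate expression of the Riemannian metric in the chart at `p`. -/
noncomputable def metricRep (p : M) (y : E) : E →L[ℝ] E →L[ℝ] ℝ :=
  ContinuousLinearMap.precomp ℝ (ofCoord p ((extChartAt 𝓘(ℝ, E) p).symm y)) ∘L
    innerSL ℝ ∘L ofCoord p ((extChartAt 𝓘(ℝ, E) p).symm y)

lemma metricRep_apply (p : M) (y a b : E) : metricRep p y a b =
    inner ℝ (ofCoord p ((extChartAt 𝓘(ℝ, E) p).symm y) a)
      (ofCoord p ((extChartAt 𝓘(ℝ, E) p).symm y) b) := rfl

lemma metricRep_apply_eq_comp (p : M) (a b : E) : (fun y ↦ metricRep p y a b) =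
    (fun z : M ↦ (inner ℝ (coordField (M := M) p (fun _ ↦ a) z)
      (coordField (M := M) p (fun _ ↦ b) z) : ℝ)) ∘ (extChartAt 𝓘(ℝ, E) p).symm := rfl

lemma metricRep_symm (p : M) (y a b : E) : metricRep p y a b = metricRep p y b a := by
  rw [metricRep_apply, metricRep_apply, real_inner_comm]

lemma metricRep_pos (hy : y ∈ (extChartAt 𝓘(ℝ, E) p).target) {a : E} (ha : a ≠ 0) :
    0 < metricRep p y a a := by
  rw [metricRep_apply]
  refine real_inner_self_pos.2 fun h ↦ ha ?_
  rw [← toCoord_ofCoord (extChartAt_symm_mem_source hy) a, h, map_zero]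

variable [IsContMDiffRiemannianBundle 𝓘(ℝ, E) ∞ E (fun x : M ↦ TangentSpace 𝓘(ℝ, E) x)]

lemma contMDiffAt_inner_coordField (hx : x ∈ (chartAt E p).source) (a b : E) :
    ContMDiffAt 𝓘(ℝ, E) 𝓘(ℝ, ℝ) ∞ (fun z : M ↦ (inner ℝ (coordField (M := M) p (fun _ ↦ a) z)
      (coordField (M := M) p (fun _ ↦ b) z) : ℝ)) x :=
  ContMDiffAt.inner_bundle (contMDiffAt_coordField_const hx a) (contMDiffAt_coordField_const hx b)

variable [FiniteDimensional ℝ E]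
  {cov : CovariantDerivative 𝓘(ℝ, E) E (TangentSpace 𝓘(ℝ, E) : M → Type _)}

lemma torsion_dual (h : IsStatistical cov) : (dual cov).torsion = 0 := by
  have := FiniteDimensional.complete ℝ E
  refine (CovariantDerivative.torsion_eq_zero_iff _).2 fun {X Y x} hX hY ↦ ?_
  have hcubic : cubicFormLast cov x (X x) (Y x) = cubicFormLast cov x (Y x) (X x) := by
    ext w
    exact (h.cubicForm_symm x (X x) (Y x) w).1
  have hdual (Z : Π x : M, TangentSpace 𝓘(ℝ, E) x) (v : TangentSpace 𝓘(ℝ, E) x) :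
      dual cov Z x v = cov Z x v + sharp x (cubicFormLast cov x v (Z x)) := rfl
  rw [← (CovariantDerivative.torsion_eq_zero_iff _).1 h.torsion_eq_zero hX hY, hdual, hdual,
    hcubic, add_sub_add_right_eq_sub]

lemma contDiffOn_metricRep :
    ContDiffOn ℝ ∞ (metricRep (M := M) p) (extChartAt 𝓘(ℝ, E) p).target := by
  refine contDiffOn_clm_apply₂.2 fun a b y hy ↦ ?_
  obtain ⟨x, hx, rfl⟩ := exists_extChartAt_eq hy
  exact ((contMDiffAt_iff_contDiffAt_comp_symm hx).1
    (contMDiffAt_inner_coordField hx a b)).contDiffWithinAt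

lemma fderiv_metricRep (hy : y ∈ (extChartAt 𝓘(ℝ, E) p).target) (u a b : E) :
    fderiv ℝ (metricRep p) y u a b = metricRep p y (christoffel cov p y a u) b +
      metricRep p y a (christoffel (dual cov) p y b u) := by
  have hmetric := (contDiffOn_metricRep.contDiffAt
    ((isOpen_extChartAt_target p).mem_nhds hy)).differentiableAt (by simp)
  rw [← fderiv_clm_apply₂_const hmetric]
  obtain ⟨x, hx, rfl⟩ := exists_extChartAt_eq hy
  have hsmooth (w : E) : MDiffAt (T% (coordField (M := M) p fun _ ↦ w)) x :=
    (contMDiffAt_coordField_const hx w).mdifferentiableAt (by simp)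
  have hcompat := dual_spec cov (hsmooth a) (hsmooth b) (ofCoord p x u)
  have hfderiv := mvfderiv_eq_fderiv hx
    ((contMDiffAt_inner_coordField hx a b).mdifferentiableAt (by simp)) (ofCoord p x u)
  rw [toCoord_ofCoord hx] at hfderiv
  rw [metricRep_apply_eq_comp, ← hfderiv, hcompat, christoffel_apply hx, christoffel_apply hx,
    metricRep_apply, metricRep_apply, extChartAt_left_inv hx, ofCoord_toCoord hx,
    ofCoord_toCoord hx]
  rfl

lemma contDiffOn_christoffel_dual
    (hΓ : ContDiffOn ℝ ∞ (christoffel cov p) (extChartAt 𝓘(ℝ, E) p).target) :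
    ContDiffOn ℝ ∞ (christoffel (dual cov) p) (extChartAt 𝓘(ℝ, E) p).target := by
  have hg : ContDiffOn ℝ ∞ (metricRep (M := M) p) (extChartAt 𝓘(ℝ, E) p).target :=
    contDiffOn_metricRep
  have hdg := hg.fderiv_of_isOpen (isOpen_extChartAt_target p) (m := ∞) le_rfl
  refine contDiffOn_clm_apply₂.2 fun b u ↦ contDiffOn_of_contDiffOn_metric_apply hg
    (fun y hy a ha ↦ metricRep_pos hy ha) fun a ↦ ?_
  have hcompat : ContDiffOn ℝ ∞ (fun y ↦ fderiv ℝ (metricRep p) y u a b -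
      metricRep p y (christoffel cov p y a u) b) (extChartAt 𝓘(ℝ, E) p).target :=
    (((hdg.clm_apply contDiffOn_const).clm_apply contDiffOn_const).clm_apply contDiffOn_const).sub
      ((hg.clm_apply (contDiffOn_clm_apply₂.1 hΓ a u)).clm_apply contDiffOn_const)
  refine hcompat.congr fun y hy ↦ ?_
  rw [fderiv_metricRep (cov := cov) hy, add_sub_cancel_left, metricRep_symm]

lemma isConjugatePairOn_christoffel [T2Space M] (h : IsStatistical cov)
    (hconj : IsConjugateSymmetric cov) (p : M) :
    IsConjugatePairOn (metricRep p) (christoffel cov p) (christoffel (dual cov) p)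
      (extChartAt 𝓘(ℝ, E) p).target where
  isOpen := isOpen_extChartAt_target p
  contDiffOn_metric := contDiffOn_metricRep
  contDiffOn := contDiffOn_christoffel h.smooth
  contDiffOn' := contDiffOn_christoffel_dual (contDiffOn_christoffel h.smooth)
  metric_symm y _ a b := metricRep_symm p y a b
  metric_pos y hy a ha := metricRep_pos hy ha
  symm y hy := christoffel_symm h.torsion_eq_zero hy
  symm' y hy := christoffel_symm (torsion_dual h) hy
  compat y hy := fderiv_metricRep hy
  curvature_eq y hy u v w := by
    have htarget := (isOpen_extChartAt_target p).mem_nhds hy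
    have hΓ_target : ContDiffOn ℝ ∞ (christoffel cov p) (extChartAt 𝓘(ℝ, E) p).target :=
      contDiffOn_christoffel h.smooth
    have hΓ := hΓ_target.contDiffAt htarget
    have hΓ' := (contDiffOn_christoffel_dual hΓ_target).contDiffAt htarget
    obtain ⟨x, hx, rfl⟩ := exists_extChartAt_eq hy
    obtain ⟨X, hX, rfl⟩ := exists_contMDiff_toCoord_eq hx u
    obtain ⟨Y, hY, rfl⟩ := exists_contMDiff_toCoord_eq hx v
    obtain ⟨Z, hZ, rfl⟩ := exists_contMDiff_toCoord_eq hx w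
    rw [← toCoord_curvature hx hΓ hX.contMDiffAt hY.contMDiffAt hZ.contMDiffAt,
      ← toCoord_curvature hx hΓ' hX.contMDiffAt hY.contMDiffAt hZ.contMDiffAt,
      hconj X Y Z hX hY hZ x]

end Dual

end StatGeom

theorem proposition2p2_general {E : Type*} [NormedAddCommGroup E] [NormedSpace ℝ E]
    [FiniteDimensional ℝ E] {M : Type*} [TopologicalSpace M] [T2Space M] [ChartedSpace E M]
    [IsManifold 𝓘(ℝ, E) ∞ M] [RiemannianBundle (fun x : M ↦ TangentSpace 𝓘(ℝ, E) x)]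
    [IsContMDiffRiemannianBundle 𝓘(ℝ, E) ∞ E (fun x : M ↦ TangentSpace 𝓘(ℝ, E) x)]
    (cov : CovariantDerivative 𝓘(ℝ, E) E (TangentSpace 𝓘(ℝ, E) : M → Type _))
    (hstat : StatGeom.IsStatistical cov) (hconj : StatGeom.IsConjugateSymmetric cov) :
    StatGeom.IsProjectivelyFlat cov ↔ StatGeom.IsProjectivelyFlat (StatGeom.dual cov) := by
  have hpair := StatGeom.isConjugatePairOn_christoffel hstat hconj
  rw [StatGeom.isProjectivelyFlat_iff hstat.torsion_eq_zero fun p ↦ (hpair p).contDiffOn,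
    StatGeom.isProjectivelyFlat_iff (StatGeom.torsion_dual hstat) fun p ↦ (hpair p).contDiffOn']
  exact forall_congr' fun p ↦ (hpair p).isProjectivelyFlatAt_iff (mem_extChartAt_target p)

theorem proposition2p2 (n : ℕ) {M : Type*} [TopologicalSpace M] [T2Space M]
    [SecondCountableTopology M] [ChartedSpace (EuclideanSpace ℝ (Fin n)) M] [IsManifold (𝓡 n) ∞ M]
    [RiemannianBundle (fun x : M ↦ TangentSpace (𝓡 n) x)]
    [IsContMDiffRiemannianBundle (𝓡 n) ∞ (EuclideanSpace ℝ (Fin n))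
      (fun x : M ↦ TangentSpace (𝓡 n) x)]
    (cov : CovariantDerivative (𝓡 n) (EuclideanSpace ℝ (Fin n))
      (TangentSpace (𝓡 n) : M → Type _))
    (hstat : StatGeom.IsStatistical cov) (hconj : StatGeom.IsConjugateSymmetric cov) :
    StatGeom.IsProjectivelyFlat cov ↔ StatGeom.IsProjectivelyFlat (StatGeom.dual cov) :=
  proposition2p2_general cov hstat hconj
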